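/- Let $R=(R,+,\cdot,0,1,\dots)$ be a (not necessarily commutative) unital ring, possibly with additional first-order structure, in a language $L$ expanding the language of rings. Let $\bar R\succ R$ be a $\kappa$-saturated and strongly $\kappa$-homogeneous elementary extension, where $\kappa>|R|+|L|$ is a strong limit cardinal ($|L|$ is the number of $L$-formulas, so $\kappa>\aleph_0$). A subset of a power of $\bar R$ is *$R$-type-definable* if it is an intersection of sets definable with parameters from $R$; a parameter set is *small* if it has fewer than $\kappa$ elements. For a group $G$ definable in $R$ with interpretation $\bar G$ in $\bar R$, let $\bar G^{00}_R$ be the smallest $R$-type-definable subgroup of $\bar G$ of index less than $\kappa$; it exists and is normal. A quotient carries the *logic topology*: a set is closed iff its preimage is type-definable over a small set. A *definable compactification* of $G$ is a homomorphism $\phi\colon G\to K$ with dense image into a compact Hausdorff topological group such that for disjoint closed $C_1,C_2\subseteq K$ there are disjoint definable (with parameters from $R$) sets $U_1,U_2\subseteq G$ with $\phi^{-1}[C_i]\subseteq U_i$. It is the *definable Bohr compactification* of $G$ if every definable compactification $\phi'\colon G\to K'$ is $f\circ\phi$ for a unique continuous homomorphism $f\colon K\to K'$. Let $B=(\bar R,+)$,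 let $I_1=B^{00}_R$, and for $k\ge 1$ let $I_{k+1}$ be the smallest $R$-type-definable subgroup of $B$ containing $\bar R\cdot I_k$. For a unital ring $S$ let $\mathrm{UT}_n(S)$ be the group of upper unitriangular $n\times n$ matrices over $S$. Then: 1. If $i,j<k$, then $(a+I_i)(b+I_j)\subseteq ab+I_k$ for all $a,b\in\bar R$. Hence matrix multiplication $$(xy)_{ij}=x_{ij}+y_{ij}+\sum_{i<k<j}x_{ik}\,y_{kj}$$ is well defined on the set $H_n$ of unitriangular $n\times n$ "matrices" whose $(i,j)$ entry, for $i<j$, lies in $B/I_{j-i}$, and it makes $H_n$ a group. We equip $H_n$ with the product of the logic topologies on the quotients $B/I_{j-i}$. 2. The natural map $\mathrm{UT}_n(R)\to \mathrm{UT}_n(\bar R)/\mathrm{UT}_n(\bar R)^{00}_R$ is the definable Bohr compactification of the (discrete) group $\mathrm{UT}_n(R)$, and the coordinatewise quotient map $[a_{ij}]\mapsto[a_{ij}+I_{j-i}]$ induces an isomorphism of topological groups $$\mathrm{UT}_n(\bar R)/\mathrm{UT}_n(\bar R)^{00}_R\;\cong\; H_n .$$ 3. The natural map $(R,+)\to B/I_1$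 is the definable Bohr compactification of $(R,+)$. 4. The definable Bohr compactification of $\mathrm{UT}_n(R)$ is the homomorphism $\mathrm{UT}_n(R)\to H_n$ given coordinatewise by the quotient maps, $[a_{ij}]\mapsto[a_{ij}+I_{j-i}]$. -/

import Mathlib

open FirstOrder
open scoped Cardinal Topology FirstOrder

universe u v w w' t

namespace DefBohr

section ModelTheory

/-! ### Saturation and homogeneity -/

/-- `M` is `κ`-saturated: over every parameter set `A` of size `< κ`, every finitely satisfiable
family of `A`-definable subsets of `M ^ n` (that is, every partial `n`-type over `A`) has a
common point. -/
def IsSaturated (L : FirstOrder.Language.{u, v}) (κ : Cardinal.{w}) (M : Type w) [L.Structure M] : Prop :=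
  ∀ A : Set M, #A < κ → ∀ (n : ℕ) (S : Set (Set (Fin n → M))),
    (∀ D ∈ S, A.Definable L D) →
    (∀ F ⊆ S, F.Finite → (⋂₀ F).Nonempty) →
    (⋂₀ S).Nonempty

/-- `M` is strongly `κ`-homogeneous: every partial elementary map `f : A → M` with `#A < κ`
extends to an automorphism of `M`. -/
def IsStronglyHomogeneous (L : FirstOrder.Language.{u, v}) (κ : Cardinal.{w}) (M : Type w)
    [L.Structure M] : Prop :=
  ∀ A : Set M, #A < κ → ∀ f : A → M,
    (∀ (n : ℕ) (ψ : L.Formula (Fin n)) (x : Fin n → A),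
      ψ.Realize (fun i => (x i : M)) ↔ ψ.Realize (fun i => f (x i))) →
    ∃ σ : M ≃[L] M, ∀ a : A, σ a = f a

/-- The elementary extension `j : M ≺ N` is `κ`-saturated and strongly `κ`-homogeneous, where `κ`
is a strong limit cardinal bigger than `|M| + |L|` (with `|L|` the number of `L`-formulas,
that is, `ℵ₀` plus the number of symbols). -/
structure IsMonster {L : FirstOrder.Language.{u, v}} {M : Type w} {N : Type w'} [L.Structure M]
    [L.Structure N] (κ : Cardinal.{w'}) (_j : M ↪ₑ[L] N) : Prop where
  strongLimit : κ.IsStrongLimit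
  aleph0_lt : ℵ₀ < κ
  card_model_lt : Cardinal.lift.{w'} #M < Cardinal.lift.{w} κ
  card_language_lt : Cardinal.lift.{w'} L.card < Cardinal.lift.{max u v} κ
  saturated : IsSaturated L κ N
  homogeneous : IsStronglyHomogeneous L κ N

/-! ### Definable and type-definable sets, connected components, logic topology

A set `G` "living in" a power `α → M` of the structure is given together with its (injective)
coordinate map `c : G → (α → M)`; a subset of `G` is called definable if its image is. -/

variable (L : FirstOrder.Language.{u, v}) {M : Type w} [L.Structure M] (A : Set M)
  {G : Type*} {α : Type*} (c : G → α → M)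

/-- `X ⊆ G` is `A`-definable. -/
def IsDefinable (X : Set G) : Prop := A.Definable L (c '' X)

/-- `X ⊆ G` is `A`-type-definable: an intersection of `A`-definable sets. -/
def IsTypeDefinable (X : Set G) : Prop :=
  ∃ S : Set (Set (α → M)), (∀ D ∈ S, A.Definable L D) ∧ c '' X = ⋂₀ S

/-- The `A`-type-definable subgroups of `G` of bounded index. -/
def boundedTypeDefinable [Group G] (κ : Cardinal) : Set (Subgroup G) :=
  {H | IsTypeDefinable L A c (H : Set G) ∧ #(G ⧸ H) < κ}

/-- The component `G^00_A`: the smallest `A`-type-definable subgroup of `G` of bounded index. -/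
def comp00 [Group G] (κ : Cardinal) : Subgroup G := sInf (boundedTypeDefinable L A c κ)

/-- The `A`-type-definable subgroups of bounded index of an additive group. -/
def addBoundedTypeDefinable [AddGroup G] (κ : Cardinal) : Set (AddSubgroup G) :=
  {H | IsTypeDefinable L A c (H : Set G) ∧ #(G ⧸ H) < κ}

/-- The component `(G,+)^00_A` of an additive group. -/
def addComp00 [AddGroup G] (κ : Cardinal) : AddSubgroup G :=
  sInf (addBoundedTypeDefinable L A c κ)

/-- The logic topology on a quotient `q : G → Q`: the closed sets are the sets whose preimage is
type-definable over a parameter set of size `< κ`. (Declared as the topology generated by the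
complements of such sets, so that it makes sense for every `q`.) -/
@[reducible]
def logicTopology (κ : Cardinal.{w}) {Q : Type*} (q : G → Q) : TopologicalSpace Q :=
  TopologicalSpace.generateFrom
    {U | ∃ B : Set M, #B < κ ∧ IsTypeDefinable L B c (q ⁻¹' Uᶜ)}

/-- The topology `τ` on the quotient `q : G → Q` has as closed sets exactly the sets whose
preimage is type-definable over a parameter set of size `< κ`. -/
def IsLogicTopology (κ : Cardinal.{w}) {Q : Type*} (q : G → Q) (τ : TopologicalSpace Q) : Prop :=
  ∀ C : Set Q, IsClosed[τ] C ↔ ∃ B : Set M, #B < κ ∧ IsTypeDefinable L B c (q ⁻¹' C)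

/-! ### Definable compactifications -/

/-- `φ : G → K` is a definable compactification of the group `G` definable in `M` via `c`:
`K` is a compact Hausdorff topological group, `φ` has dense image, and preimages of disjoint closed
sets are separated by disjoint sets definable with parameters from `M`. -/
structure IsDefinableCompactification [Group G] {K : Type*} [Group K] [TopologicalSpace K]
    (φ : G →* K) : Prop where
  topologicalGroup : IsTopologicalGroup K
  compact : CompactSpace K
  hausdorff : T2Space K
  dense : DenseRange φ
  definable : ∀ C₁ C₂ : Set K, IsClosed C₁ → IsClosed C₂ → Disjoint C₁ C₂ →
    ∃ U₁ U₂ : Set G, IsDefinable L Set.univ c U₁ ∧ IsDefinable L Set.univ c U₂ ∧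
      Disjoint U₁ U₂ ∧ φ ⁻¹' C₁ ⊆ U₁ ∧ φ ⁻¹' C₂ ⊆ U₂

/-- `φ : G → K` is the definable Bohr compactification of `G`: the universal definable
compactification (with respect to compactifications in an arbitrary universe `t`). -/
def IsDefinableBohr [Group G] {K : Type*} [Group K] [TopologicalSpace K] (φ : G →* K) : Prop :=
  IsDefinableCompactification L c φ ∧
  ∀ (K' : Type t) [Group K'] [TopologicalSpace K'] (φ' : G →* K'),
    IsDefinableCompactification L c φ' →
    ∃! f : K →ₜ* K', ∀ g : G, φ' g = f (φ g)

end ModelTheory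

section Rings

/-! ### Unitriangular matrices -/

/-- `UT_n(S)`: upper triangular `n × n` matrices over `S` with all diagonal entries `1`. -/
def UT (n : ℕ) (S : Type*) [Ring S] : Submonoid (Matrix (Fin n) (Fin n) S) where
  carrier := {a | (∀ i j, j < i → a i j = 0) ∧ ∀ i, a i i = 1}
  one_mem' := ⟨fun _ _ h => Matrix.one_apply_ne h.ne', fun i => Matrix.one_apply_eq i⟩
  mul_mem' := by
    rintro a b ⟨ha, ha'⟩ ⟨hb, hb'⟩
    refine ⟨fun i j hij => ?_, fun i => ?_⟩
    · rw [Matrix.mul_apply]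
      refine Finset.sum_eq_zero fun k _ => ?_
      rcases lt_or_ge k i with h | h
      · rw [ha i k h, zero_mul]
      · rw [hb k j (hij.trans_le h), mul_zero]
    · rw [Matrix.mul_apply, Finset.sum_eq_single i, ha', hb', one_mul]
      · intro k _ hk
        rcases lt_or_gt_of_ne hk with h | h
        · rw [ha i k h, zero_mul]
        · rw [hb k i h, mul_zero]
      · simp

variable {n : ℕ} {S : Type*} [Ring S]

theorem UT.pow_apply_eq_zero (a : UT n S) (m : ℕ) (i j : Fin n) (h : (j : ℕ) < i + m) :
    ((1 - (a : Matrix (Fin n) (Fin n) S)) ^ m) i j = 0 := by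
  induction m generalizing i with
  | zero => rw [pow_zero]; exact Matrix.one_apply_ne (Fin.ne_of_gt (by simpa using h))
  | succ m ih =>
    rw [pow_succ', Matrix.mul_apply]
    refine Finset.sum_eq_zero fun k _ => ?_
    rcases lt_trichotomy k i with hk | hk | hk
    · rw [Matrix.sub_apply, Matrix.one_apply_ne hk.ne', a.2.1 i k hk]; simp
    · subst hk
      rw [Matrix.sub_apply, Matrix.one_apply_eq, a.2.2 k]; simp
    · rw [ih k (by have : (i : ℕ) < k := hk; omega), mul_zero]

/-- `UT_n(S)` is a group under matrix multiplication. -/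
instance UT.instGroup : Group (UT n S) :=
  { (inferInstance : Monoid (UT n S)) with
    inv := fun a => ⟨∑ m ∈ Finset.range n, (1 - (a : Matrix (Fin n) (Fin n) S)) ^ m, by
      refine ⟨fun i j hij => ?_, fun i => ?_⟩
      · rw [Matrix.sum_apply]
        refine Finset.sum_eq_zero fun m _ => UT.pow_apply_eq_zero a m i j ?_
        have : (j : ℕ) < i := hij
        omega
      · rw [Matrix.sum_apply, Finset.sum_eq_single 0]
        · rw [pow_zero, Matrix.one_apply_eq]
        · intro m _ hm
          exact UT.pow_apply_eq_zero a m i i (by omega)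
        · intro h
          exact absurd (Finset.mem_range.2 (i.pos)) h⟩
    inv_mul_cancel := fun a => by
      apply Subtype.ext
      change (∑ m ∈ Finset.range n, (1 - (a : Matrix (Fin n) (Fin n) S)) ^ m) * a.1 = 1
      have h := geom_sum_mul_neg (1 - (a : Matrix (Fin n) (Fin n) S)) n
      rw [sub_sub_cancel] at h
      rw [h, sub_eq_self]
      ext i j
      exact UT.pow_apply_eq_zero a n i j (by omega) }

/-- The homomorphism `UT_n(S) → UT_n(T)` induced by a ring homomorphism. -/
def UT.map {T : Type*} [Ring T] (f : S →+* T) : UT n S →* UT n T where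
  toFun a := ⟨(a : Matrix (Fin n) (Fin n) S).map f,
    ⟨fun i j h => by rw [Matrix.map_apply, a.2.1 i j h, map_zero],
      fun i => by rw [Matrix.map_apply, a.2.2 i, map_one]⟩⟩
  map_one' := Subtype.ext (Matrix.map_one f (map_zero f) (map_one f))
  map_mul' a b := Subtype.ext (Matrix.map_mul (f := f))

/-- The coordinate map `UT_n(S) → S ^ (n × n)`. -/
def utCoord (n : ℕ) (S : Type*) [Ring S] : UT n S → Fin n × Fin n → S :=
  fun a p => (a : Matrix (Fin n) (Fin n) S) p.1 p.2

/-- The coordinate map of the group `(S, +)`. -/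
def ringCoord (S : Type*) : S → Fin 1 → S := fun x _ => x

/-! ### Unitriangular "matrices" with entries in the quotients `S / I (j - i)` -/

/-- Multiplication of cosets `S / I i × S / I j → S / I k` is well defined whenever `i, j < k`. -/
def CosetMulWellDefined (I : ℕ → AddSubgroup S) : Prop :=
  ∀ i j k : ℕ, 1 ≤ i → 1 ≤ j → i < k → j < k →
    ∀ a b x y : S, x ∈ I i → y ∈ I j → (a + x) * (b + y) - a * b ∈ I k

/-- The product of a coset of `I i` and a coset of `I j`, as a coset of `I k`, for `i, j < k`. -/
def cosetMul {I : ℕ → AddSubgroup S} (hI : CosetMulWellDefined I) {i j k : ℕ}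
    (h : 1 ≤ i ∧ 1 ≤ j ∧ i < k ∧ j < k) : S ⧸ I i → S ⧸ I j → S ⧸ I k :=
  Quotient.map₂ (· * ·) (by
    intro a a' ha b b' hb
    rw [← Quotient.eq_iff_equiv, Quotient.eq, QuotientAddGroup.leftRel_apply] at ha hb ⊢
    have := hI i j k h.1 h.2.1 h.2.2.1 h.2.2.2 a b _ _ ha hb
    simpa [sub_eq_neg_add] using this)

/-- Unitriangular `n × n` "matrices" whose `(i,j)` entry, for `i < j`, lies in `S / I (j - i)`;
only the entries above the diagonal are recorded. -/
def UTQuot (I : ℕ → AddSubgroup S) (n : ℕ) : Type _ :=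
  (p : {p : Fin n × Fin n // p.1 < p.2}) → S ⧸ I (p.1.2 - p.1.1 : ℕ)

namespace UTQuot

variable {I : ℕ → AddSubgroup S}

/-- The `(i,j)` entry of `x`, for `i < j`. -/
def entry (x : UTQuot I n) {i j : Fin n} (h : i < j) : S ⧸ I (j - i : ℕ) := x ⟨(i, j), h⟩

/-- The coordinatewise quotient map `UT_n(S) → UTQuot I n`. -/
def mk (I : ℕ → AddSubgroup S) (a : UT n S) : UTQuot I n :=
  fun p => QuotientAddGroup.mk ((a : Matrix (Fin n) (Fin n) S) p.1.1 p.1.2)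

/-- Matrix multiplication: the `(i,j)` entry of `x * y` is
`x i j + y i j + ∑_{i < k < j} x i k * y k j`. -/
def mul (hI : CosetMulWellDefined I) (x y : UTQuot I n) : UTQuot I n := fun p =>
  x p + y p + ∑ k : {k : Fin n // p.1.1 < k ∧ k < p.1.2},
    cosetMul hI
      (by have h₁ : (p.1.1 : ℕ) < k.1 := k.2.1
          have h₂ : (k.1 : ℕ) < p.1.2 := k.2.2
          omega)
      (entry x k.2.1) (entry y k.2.2)

theorem mk_surjective : Function.Surjective (mk I : UT n S → UTQuot I n) := by
  intro x
  choose r hr using fun p => QuotientAddGroup.mk_surjective (x p)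
  refine ⟨⟨fun i j => if h : i < j then r ⟨(i, j), h⟩ else if i = j then 1 else 0,
    fun i j h => ?_, fun i => ?_⟩, ?_⟩
  · simp [h.not_gt, h.ne']
  · simp
  · funext p
    rw [← hr p]
    have h : p.1.1 < p.1.2 := p.2
    simp [mk, h]

theorem mk_mul (hI : CosetMulWellDefined I) (a b : UT n S) :
    mk I (a * b) = mul hI (mk I a) (mk I b) := by
  funext p
  obtain ⟨⟨i, j⟩, hij⟩ := p
  change i < j at hij
  have key : ((a * b : UT n S) : Matrix (Fin n) (Fin n) S) i j =
      a.1 i j + b.1 i j + ∑ k : {k : Fin n // i < k ∧ k < j}, a.1 i k * b.1 k j := by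
    change (a.1 * b.1) i j = _
    have hterm : ∀ k, a.1 i k * b.1 k j = (if k = j then a.1 i j else 0) +
        (if k = i then b.1 i j else 0) + if i < k ∧ k < j then a.1 i k * b.1 k j else 0 := by
      intro k
      rcases lt_trichotomy k i with h | rfl | h
      · simp [a.2.1 i k h, h.ne, h.not_gt, (h.trans hij).ne]
      · simp [a.2.2 k, hij.ne]
      · rcases lt_trichotomy k j with h' | rfl | h'
        · simp [h, h', h.ne', h'.ne]
        · simp [b.2.2 k, h.ne']
        · simp [b.2.1 k j h', h.ne', h'.ne', h'.not_gt]
    rw [Matrix.mul_apply, Finset.sum_congr rfl fun k _ => hterm k, Finset.sum_add_distrib,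
      Finset.sum_add_distrib, Finset.sum_ite_eq' Finset.univ j, Finset.sum_ite_eq' Finset.univ i,
      ← Finset.sum_filter, Finset.sum_subtype (F := inferInstance)
        (p := fun k => i < k ∧ k < j) _ (by simp)]
    simp
  change QuotientAddGroup.mk (((a * b : UT n S) : Matrix (Fin n) (Fin n) S) i j) = _
  rw [key, QuotientAddGroup.mk_add, QuotientAddGroup.mk_add]
  refine congrArg _ ?_
  exact map_sum (QuotientAddGroup.mk' (I (j - i : ℕ))) _ _

/-- The group of unitriangular "matrices" with entries in the quotients `S / I (j - i)`, with
matrix multiplication as the group operation. -/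
@[reducible]
noncomputable def group (hI : CosetMulWellDefined I) (n : ℕ) : Group (UTQuot I n) :=
  letI : Mul (UTQuot I n) := ⟨mul hI⟩
  letI : One (UTQuot I n) := ⟨mk I 1⟩
  letI : Inv (UTQuot I n) := ⟨fun x => mk I (Function.surjInv mk_surjective x)⁻¹⟩
  Group.ofLeftAxioms
    (fun x y z => by
      obtain ⟨a, rfl⟩ := mk_surjective x
      obtain ⟨b, rfl⟩ := mk_surjective y
      obtain ⟨c, rfl⟩ := mk_surjective z
      change mul hI (mul hI _ _) _ = mul hI _ (mul hI _ _)
      rw [← mk_mul, ← mk_mul, ← mk_mul, ← mk_mul, mul_assoc])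
    (fun x => by
      obtain ⟨a, rfl⟩ := mk_surjective x
      change mul hI (mk I 1) _ = _
      rw [← mk_mul, one_mul])
    (fun x => by
      obtain ⟨a, ha⟩ : ∃ a, a = Function.surjInv mk_surjective x := ⟨_, rfl⟩
      change mul hI (mk I (Function.surjInv mk_surjective x)⁻¹) x = mk I 1
      conv_lhs => rw [← Function.surjInv_eq mk_surjective x]
      rw [Function.surjInv_eq mk_surjective x, ← ha, ← Function.surjInv_eq mk_surjective x,
        ← ha, ← mk_mul, inv_mul_cancel])

/-- The coordinatewise quotient map as a group homomorphism. -/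
def mkHom (hI : CosetMulWellDefined I) (n : ℕ) :
    letI := group hI n
    UT n S →* UTQuot I n :=
  letI := group hI n
  { toFun := mk I
    map_one' := rfl
    map_mul' := mk_mul hI }

/-- The product topology induced by topologies on the quotients `S / I k`. -/
@[reducible]
def topology (τ : ∀ k, TopologicalSpace (S ⧸ I k)) (n : ℕ) : TopologicalSpace (UTQuot I n) :=
  @Pi.topologicalSpace _ _ fun _ => τ _

end UTQuot

end Rings

section Main

/-! ### The sequence of subgroups `I k` and the homomorphism induced by `R ≺ N` -/

/-- The sequence `I 1, I 2, …` of `A`-type-definable subgroups of `(N,+)`: `I 1 = (N,+)^00_A`, and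
`I (k+1)` is the smallest `A`-type-definable subgroup containing `N · I k`.
(The value at the index `0` is not used.) -/
def iSeq (L : FirstOrder.Language.{u, v}) {N : Type w} [Ring N] [L.Structure N] (A : Set N)
    (κ : Cardinal.{w}) : ℕ → AddSubgroup N
  | 0 => ⊥
  | 1 => addComp00 L A (ringCoord N) κ
  | k + 2 => sInf {H | IsTypeDefinable L A (ringCoord N) (H : Set N) ∧
      ∀ r : N, ∀ x ∈ iSeq L A κ (k + 1), r * x ∈ H}

open FirstOrder.Ring in
/-- An elementary embedding of rings with additional structure (structures in a language that
expands the language of rings) is a ring homomorphism. -/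
def elemRingHom {L : FirstOrder.Language.{u, v}} {R : Type w} {N : Type w'} [Ring R] [Ring N]
    [CompatibleRing R] [CompatibleRing N] [L.Structure R] [L.Structure N]
    (ι : FirstOrder.Language.ring →ᴸ L) [ι.IsExpansionOn R] [ι.IsExpansionOn N] (j : R ↪ₑ[L] N) :
    R →+* N where
  toFun := j
  map_zero' := by
    have := j.map_fun (ι.onFunction zeroFunc) ![]
    rw [FirstOrder.Language.LHom.map_onFunction, FirstOrder.Language.LHom.map_onFunction] at this
    exact (congrArg j (CompatibleRing.funMap_zero ![])).symm.trans
      (this.trans (CompatibleRing.funMap_zero _))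
  map_one' := by
    have := j.map_fun (ι.onFunction oneFunc) ![]
    rw [FirstOrder.Language.LHom.map_onFunction, FirstOrder.Language.LHom.map_onFunction] at this
    exact (congrArg j (CompatibleRing.funMap_one ![])).symm.trans
      (this.trans (CompatibleRing.funMap_one _))
  map_add' x y := by
    have := j.map_fun (ι.onFunction addFunc) ![x, y]
    rw [FirstOrder.Language.LHom.map_onFunction, FirstOrder.Language.LHom.map_onFunction] at this
    simpa using this
  map_mul' x y := by
    have := j.map_fun (ι.onFunction mulFunc) ![x, y]
    rw [FirstOrder.Language.LHom.map_onFunction, FirstOrder.Language.LHom.map_onFunction] at this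
    simpa using this

end Main

end DefBohr

open FirstOrder.Ring DefBohr

/-!
The argument uses saturation and the strong limit property of `κ` only; write `A` for the image of
`R` in `N`.

*Definable groups in coordinates.* All groups here are subsets of powers of `N` on which the
operations are given by terms (`IsDefGroup`). So a set like `{x | ∀ g, g * x * g⁻¹ ∈ D}` is
`A`-definable if `D` is, and an intersection of such sets is again `A`-type-definable; this replaces
automorphism arguments. If `H` is an `A`-type-definable subgroup of bounded index, then finitely
many translates of an `A`-definable `D ⊇ H` cover the group, and the translates can be taken by
points over `R` (`IsDefGroup.exists_finset_points_cover`). Hence elements with the same type over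
`R` lie in the same coset of `H`, and as there are fewer than `κ` types, the intersection of all
such `H` still has bounded index (`IsDefGroup.isLeast_comp00`), although `κ` may be singular.

*The Bohr compactification.* Let `q : G → Q` be surjective with `A`-type-definable kernel of bounded
index. The images of the `A`-definable sets containing the kernel are a basis of neighbourhoods of
the identity for the logic topology, and `Q` is a compact Hausdorff group. Conversely, a definable
compactification `φ` of the `R`-points converges along every type over `R`, which extends `φ` to a
homomorphism on all of `G` with `A`-type-definable kernel of bounded index
(`IsDefinableCompactification.exists_extension`). So if the kernel of `q` is `G^00`, then `q`
restricted to the `R`-points is the definable Bohr compactification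
(`IsBoundedQuotient.isDefinableBohr`).

*Unitriangular matrices.* The definition of the subgroups `I k` gives `N * I k ⊆ I (k + 1)`;
`mul_mem_iSeq_right` shows that also `I k * N ⊆ I (k + 1)`, which makes the group of matrices of
cosets well defined. The kernel of the coordinatewise quotient map is `A`-type-definable of bounded
index. It is the smallest such subgroup (`ker_mkHom_eq_comp00`): the commutator formula
for elementary matrices and the normality of `UT_n(N)^00` force this component to contain the
elementary matrices with entries in `I (k - i)` at position `(i, k)`, and these generate the kernel.
The coordinatewise quotient map is therefore a special case of `q` above; its logic topology is the
product topology since a continuous bijection from a compact to a Hausdorff space is a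
homeomorphism.
-/

namespace DefBohr

open FirstOrder.Language Set FirstOrder.Ring

/-! ### Definable sets in terms of coordinates -/

section Coordinates

variable {L : FirstOrder.Language.{u, v}} {M : Type w} [L.Structure M] {A B : Set M}
  {X Y Z : Type*} {α β γ : Type} {cX : X → α → M} {cY : Y → β → M} {cZ : Z → γ → M}

/-- The coordinate map of a product. -/
def prodCoord (cX : X → α → M) (cY : Y → β → M) : X × Y → α ⊕ β → M :=
  fun p => Sum.elim (cX p.1) (cY p.2)

variable (L A) in
/-- The coordinate map `cX` is injective and its image, a subset of a power of `M`, is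
`A`-definable. -/
structure IsCoord (cX : X → α → M) : Prop where
  injective : Function.Injective cX
  definable_range : A.Definable L (range cX)

variable (L A) in
/-- In coordinates, the map `f : X → Y` is given by `L`-terms with parameters from `A`. -/
def IsTermMap (cX : X → α → M) (cY : Y → β → M) (f : X → Y) : Prop :=
  ∀ i, ∃ s : L.Term (A ⊕ α), ∀ x, s.realize (Sum.elim (↑) (cX x)) = cY (f x) i

theorem IsTermMap.mono {f : X → Y} (h : IsTermMap L A cX cY f) (hAB : A ⊆ B) :
    IsTermMap L B cX cY f := fun i => by
  obtain ⟨s, hs⟩ := h i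
  refine ⟨s.relabel (Sum.map (inclusion hAB) id), fun x => ?_⟩
  rw [Term.realize_relabel, ← hs]
  congr 1
  ext a
  rcases a with a | a <;> rfl

theorem IsTermMap.id : IsTermMap L A cX cX id := fun i => ⟨Term.var (Sum.inr i), fun _ => rfl⟩

theorem IsTermMap.fst : IsTermMap L A (prodCoord cX cY) cX Prod.fst :=
  fun i => ⟨Term.var (Sum.inr (Sum.inl i)), fun _ => rfl⟩

theorem IsTermMap.snd : IsTermMap L A (prodCoord cX cY) cY Prod.snd :=
  fun i => ⟨Term.var (Sum.inr (Sum.inr i)), fun _ => rfl⟩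

theorem IsTermMap.const {y : Y} (hy : ∀ i, cY y i ∈ A) : IsTermMap L A cX cY fun _ => y :=
  fun i => ⟨Term.var (Sum.inl ⟨_, hy i⟩), fun _ => rfl⟩

theorem IsTermMap.prodMk {f : Z → X} {g : Z → Y} (hf : IsTermMap L A cZ cX f)
    (hg : IsTermMap L A cZ cY g) : IsTermMap L A cZ (prodCoord cX cY) fun z => (f z, g z)
  | Sum.inl i => hf i
  | Sum.inr i => hg i

theorem IsTermMap.comp {f : X → Y} {g : Y → Z} (hg : IsTermMap L A cY cZ g)
    (hf : IsTermMap L A cX cY f) : IsTermMap L A cX cZ (g ∘ f) := fun i => by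
  obtain ⟨s, hs⟩ := hg i
  choose r hr using hf
  refine ⟨s.subst (Sum.elim (fun a => Term.var (Sum.inl a)) r), fun x => ?_⟩
  rw [Term.realize_subst, Function.comp_apply, ← hs]
  congr 1
  ext a
  rcases a with a | a
  · rfl
  · exact hr a x

theorem IsCoord.mono (h : IsCoord L A cX) (hAB : A ⊆ B) : IsCoord L B cX :=
  ⟨h.1, h.2.mono hAB⟩

theorem definable_preimage_of_terms {D : Set (β → M)} (hD : A.Definable L D)
    (s : β → L.Term (A ⊕ α)) :
    A.Definable L {v : α → M | (fun i => (s i).realize (Sum.elim (↑) v)) ∈ D} := by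
  rw [definable_iff_exists_formula_sum] at hD ⊢
  obtain ⟨φ, rfl⟩ := hD
  refine ⟨BoundedFormula.subst φ (Sum.elim (fun a => Term.var (Sum.inl a)) s), ?_⟩
  ext v
  change _ ↔ BoundedFormula.Realize _ _ _
  rw [BoundedFormula.realize_subst]
  change BoundedFormula.Realize _ _ _ ↔ _
  apply iff_of_eq
  congr 1
  ext a
  rcases a with a | a <;> rfl

theorem IsDefinable.mono {D : Set X} (h : IsDefinable L A cX D) (hAB : A ⊆ B) :
    IsDefinable L B cX D := Set.Definable.mono h hAB

theorem IsDefinable.preimage {D : Set Y} (hD : IsDefinable L A cY D) (hX : IsCoord L A cX)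
    (hY : Function.Injective cY) {f : X → Y} (hf : IsTermMap L A cX cY f) :
    IsDefinable L A cX (f ⁻¹' D) := by
  choose s hs using hf
  have := hX.2.inter (definable_preimage_of_terms hD s)
  refine (congrArg (A.Definable L) ?_).mp this
  ext v
  constructor
  · rintro ⟨⟨x, rfl⟩, y, hy, hyx⟩
    refine ⟨x, ?_, rfl⟩
    have : cY y = cY (f x) := hyx.trans (funext fun i => hs i x)
    rw [mem_preimage, ← hY this]
    exact hy
  · rintro ⟨x, hx, rfl⟩
    exact ⟨⟨x, rfl⟩, f x, hx, (funext fun i => hs i x).symm⟩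

theorem IsCoord.isDefinable_univ (hX : IsCoord L A cX) : IsDefinable L A cX univ := by
  rw [IsDefinable, image_univ]
  exact hX.2

theorem isDefinable_empty : IsDefinable L A cX ∅ := by
  rw [IsDefinable, image_empty]
  exact definable_empty

theorem IsDefinable.inter (hX : Function.Injective cX) {D E : Set X} (hD : IsDefinable L A cX D)
    (hE : IsDefinable L A cX E) : IsDefinable L A cX (D ∩ E) := by
  rw [IsDefinable, image_inter hX]
  exact Set.Definable.inter hD hE

theorem IsDefinable.union {D E : Set X} (hD : IsDefinable L A cX D)
    (hE : IsDefinable L A cX E) : IsDefinable L A cX (D ∪ E) := by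
  rw [IsDefinable, image_union]
  exact Set.Definable.union hD hE

theorem IsDefinable.compl (hX : IsCoord L A cX) {D : Set X} (hD : IsDefinable L A cX D) :
    IsDefinable L A cX Dᶜ := by
  rw [IsDefinable, compl_eq_univ_sdiff, image_sdiff hX.1, image_univ]
  exact hX.2.sdiff hD

theorem IsDefinable.diff (hX : IsCoord L A cX) {D E : Set X} (hD : IsDefinable L A cX D)
    (hE : IsDefinable L A cX E) : IsDefinable L A cX (D \ E) :=
  hD.inter hX.1 (hE.compl hX)

theorem isDefinable_biUnion {ι : Type*} {s : Set ι} (hs : s.Finite) {D : ι → Set X}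
    (hD : ∀ i ∈ s, IsDefinable L A cX (D i)) : IsDefinable L A cX (⋃ i ∈ s, D i) := by
  induction s, hs using Set.Finite.induction_on with
  | empty => simpa using isDefinable_empty
  | insert _ _ ih =>
    rw [biUnion_insert]
    exact (hD _ (mem_insert _ _)).union (ih fun i hi => hD i (mem_insert_of_mem _ hi))

theorem IsCoord.prod (hX : IsCoord L A cX) (hY : IsCoord L A cY) :
    IsCoord L A (prodCoord cX cY) := by
  refine ⟨fun p q h => Prod.ext (hX.1 (funext fun i => congrFun h (Sum.inl i)))
    (hY.1 (funext fun i => congrFun h (Sum.inr i))), ?_⟩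
  have := (hX.2.preimage_comp (Sum.inl : α → α ⊕ β)).inter
    (hY.2.preimage_comp (Sum.inr : β → α ⊕ β))
  refine (congrArg (A.Definable L) ?_).mp this
  ext v
  constructor
  · rintro ⟨⟨x, hx⟩, y, hy⟩
    refine ⟨(x, y), ?_⟩
    ext i
    rcases i with i | i
    · exact congrFun hx i
    · exact congrFun hy i
  · rintro ⟨p, rfl⟩
    exact ⟨⟨p.1, rfl⟩, p.2, rfl⟩

theorem IsDefinable.exists [Finite β] {D : Set (X × Y)}
    (hD : IsDefinable L A (prodCoord cX cY) D) :
    IsDefinable L A cX {x | ∃ y, (x, y) ∈ D} := by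
  refine (congrArg (A.Definable L) ?_).mp (Set.Definable.exists_of_finite hD)
  ext v
  constructor
  · rintro ⟨u, p, hp, hpu⟩
    refine ⟨p.1, ⟨p.2, hp⟩, funext fun i => congrFun hpu (Sum.inl i)⟩
  · rintro ⟨x, ⟨y, hy⟩, rfl⟩
    exact ⟨cY y, (x, y), hy, rfl⟩

theorem IsDefinable.forall [Finite β] {D : Set (X × Y)}
    (hD : IsDefinable L A (prodCoord cX cY) D) (hX : IsCoord L A cX) (hY : IsCoord L A cY) :
    IsDefinable L A cX {x | ∀ y, (x, y) ∈ D} := by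
  refine (congrArg (IsDefinable L A cX) ?_).mp (((hD.compl (hX.prod hY)).exists).compl hX)
  ext x
  simp

/-- A set is `A`-type-definable if and only if every point outside it is excluded by an
`A`-definable superset. -/
theorem IsCoord.isTypeDefinable_iff (hX : IsCoord L A cX) {T : Set X} :
    IsTypeDefinable L A cX T ↔ ∀ x ∉ T, ∃ D, IsDefinable L A cX D ∧ T ⊆ D ∧ x ∉ D := by
  constructor
  · rintro ⟨S, hS, hT⟩ x hx
    have : cX x ∉ ⋂₀ S := by
      rw [← hT]
      rintro ⟨y, hy, hyx⟩
      exact hx (hX.1 hyx ▸ hy)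
    simp only [mem_sInter, not_forall] at this
    obtain ⟨D, hDS, hxD⟩ := this
    refine ⟨cX ⁻¹' D, ?_, fun y hy => ?_, hxD⟩
    · rw [IsDefinable, image_preimage_eq_inter_range]
      exact (hS D hDS).inter hX.2
    · exact (hT.subset (mem_image_of_mem cX hy)) D hDS
  · intro h
    refine ⟨{D | A.Definable L D ∧ cX '' T ⊆ D}, fun D hD => hD.1, ?_⟩
    refine Subset.antisymm (fun v hv D hD => hD.2 hv) fun v hv => ?_
    obtain ⟨x, rfl⟩ : v ∈ range cX := hv _ ⟨hX.2, image_subset_range _ _⟩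
    by_contra hx
    obtain ⟨D, hD, hTD, hxD⟩ := h x fun hx' => hx (mem_image_of_mem _ hx')
    obtain ⟨y, hy, hyx⟩ := hv _ ⟨hD, image_mono hTD⟩
    exact hxD (hX.1 hyx ▸ hy)

theorem IsDefinable.isTypeDefinable {D : Set X} (hD : IsDefinable L A cX D) :
    IsTypeDefinable L A cX D := ⟨{cX '' D}, by rintro _ rfl; exact hD, by simp⟩

theorem IsTypeDefinable.mono {T : Set X} (h : IsTypeDefinable L A cX T) (hAB : A ⊆ B) :
    IsTypeDefinable L B cX T := by
  obtain ⟨S, hS, hT⟩ := h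
  exact ⟨S, fun D hD => (hS D hD).mono hAB, hT⟩

theorem IsTypeDefinable.preimage {T : Set Y} (hT : IsTypeDefinable L A cY T) (hX : IsCoord L A cX)
    (hY : IsCoord L A cY) {f : X → Y} (hf : IsTermMap L A cX cY f) :
    IsTypeDefinable L A cX (f ⁻¹' T) := by
  rw [hY.isTypeDefinable_iff] at hT
  rw [hX.isTypeDefinable_iff]
  intro x hx
  obtain ⟨D, hD, hTD, hxD⟩ := hT _ hx
  exact ⟨f ⁻¹' D, hD.preimage hX hY.1 hf, preimage_mono hTD, hxD⟩

theorem IsCoord.isTypeDefinable_iInter (hX : IsCoord L A cX) {ι : Sort*} {T : ι → Set X}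
    (hT : ∀ i, IsTypeDefinable L A cX (T i)) : IsTypeDefinable L A cX (⋂ i, T i) := by
  rw [hX.isTypeDefinable_iff]
  intro x hx
  simp only [mem_iInter, not_forall] at hx
  obtain ⟨i, hi⟩ := hx
  obtain ⟨D, hD, hTD, hxD⟩ := hX.isTypeDefinable_iff.1 (hT i) x hi
  exact ⟨D, hD, (iInter_subset _ i).trans hTD, hxD⟩

/-- Type-definability is preserved by universal quantification over a definable sort. -/
theorem IsTypeDefinable.forall [Finite β] {T : Set (X × Y)}
    (hT : IsTypeDefinable L A (prodCoord cX cY) T) (hX : IsCoord L A cX) (hY : IsCoord L A cY) :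
    IsTypeDefinable L A cX {x | ∀ y, (x, y) ∈ T} := by
  rw [(hX.prod hY).isTypeDefinable_iff] at hT
  rw [hX.isTypeDefinable_iff]
  intro x hx
  simp only [mem_ofPred_eq, not_forall] at hx
  obtain ⟨y, hy⟩ := hx
  obtain ⟨D, hD, hTD, hxD⟩ := hT _ hy
  exact ⟨_, hD.forall hX hY, fun x' hx' y' => hTD (hx' y'), fun h => hxD (h y)⟩

end Coordinates

/-! ### Compactness -/

section Saturation

variable {L : FirstOrder.Language.{u, v}} {M : Type w} [L.Structure M] {A B : Set M}
  {X : Type*} {α : Type} [Finite α] {c : X → α → M} {κ : Cardinal.{w}}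

/-- Saturation for families of definable subsets of a definable set. -/
theorem IsSaturated.nonempty_sInter (hM : IsSaturated L κ M) (hA : #A < κ) (hc : IsCoord L A c)
    {S : Set (Set X)} (hS : ∀ D ∈ S, IsDefinable L A c D)
    (hfin : ∀ F ⊆ S, F.Finite → (⋂₀ F).Nonempty) : (⋂₀ S).Nonempty := by
  obtain ⟨n, ⟨e⟩⟩ := Finite.exists_equiv_fin α
  have hd : Function.Injective fun x => c x ∘ e.symm := fun x y h =>
    hc.1 (e.symm.surjective.injective_comp_right h)
  obtain ⟨v, hv⟩ := hM A hA n ((fun D => (fun x => c x ∘ e.symm) '' D) '' insert univ S)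
    (by
      rintro _ ⟨D, hD, rfl⟩
      have : IsDefinable L A c D := by
        rcases hD with rfl | hD
        exacts [hc.isDefinable_univ, hS D hD]
      have := Set.Definable.image_comp_equiv this e.symm
      rwa [image_image] at this)
    (by
      intro F hF hFfin
      lift F to Finset (Set (Fin n → M)) using hFfin
      obtain ⟨F', hF', rfl⟩ := Finset.subset_set_image_iff.1 hF
      obtain ⟨x, hx⟩ := hfin (F' \ {univ}) (by
        rintro D ⟨hD, hD'⟩
        exact (hF' hD).resolve_left hD') (F'.finite_toSet.sdiff)
      refine ⟨c x ∘ e.symm, ?_⟩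
      simp only [Finset.coe_image, sInter_image, mem_iInter]
      intro D hD
      refine ⟨x, ?_, rfl⟩
      by_cases h : D = univ
      · rw [h]; trivial
      · exact hx D ⟨hD, h⟩)
  obtain ⟨x, -, rfl⟩ := hv _ ⟨univ, mem_insert _ _, rfl⟩
  refine ⟨x, fun D hD => ?_⟩
  obtain ⟨y, hy, hyx⟩ := hv _ ⟨D, mem_insert_of_mem _ hD, rfl⟩
  exact hd hyx ▸ hy

theorem IsSaturated.nonempty_iInter (hM : IsSaturated L κ M) (hA : #A < κ) (hc : IsCoord L A c)
    {ι : Type*} {D : ι → Set X} (hD : ∀ i, IsDefinable L A c (D i))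
    (hfin : ∀ s : Finset ι, (⋂ i ∈ s, D i).Nonempty) : (⋂ i, D i).Nonempty := by
  classical
  rw [← sInter_range]
  refine hM.nonempty_sInter hA hc (by rintro _ ⟨i, rfl⟩; exact hD i) fun F hF hFfin => ?_
  lift F to Finset (Set X) using hFfin
  rw [← image_univ] at hF
  obtain ⟨s, -, rfl⟩ := Finset.subset_set_image_iff.1 hF
  rw [Finset.coe_image, sInter_image]
  exact hfin s

/-- A family of definable sets, directed downwards, whose intersection is contained in a definable
set has a member contained in it. -/
theorem IsSaturated.exists_subset_of_directed (hM : IsSaturated L κ M) (hA : #A < κ)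
    (hc : IsCoord L A c) {ι : Type*} [Nonempty ι] {D : ι → Set X} {E : Set X}
    (hD : ∀ i, IsDefinable L A c (D i)) (hE : IsDefinable L A c E)
    (hdir : ∀ i j, ∃ k, D k ⊆ D i ∩ D j) (h : ⋂ i, D i ⊆ E) : ∃ i, D i ⊆ E := by
  by_contra! hne
  obtain ⟨x, hx⟩ := hM.nonempty_sInter hA hc (S := range fun i => D i \ E)
    (by rintro _ ⟨i, rfl⟩; exact (hD i).diff hc hE)
    (by
      intro F hF hFfin
      have : ∃ k, D k \ E ⊆ ⋂₀ F := by
        induction F, hFfin using Set.Finite.induction_on with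
        | empty => exact ⟨Classical.arbitrary ι, by simp⟩
        | insert _ _ ih =>
          obtain ⟨k, hk⟩ := ih ((subset_insert _ _).trans hF)
          obtain ⟨i, hi⟩ := hF (mem_insert _ _)
          obtain ⟨l, hl⟩ := hdir i k
          refine ⟨l, ?_⟩
          rw [sInter_insert, ← hi]
          exact fun x hx => ⟨⟨(hl hx.1).1, hx.2⟩, hk ⟨(hl hx.1).2, hx.2⟩⟩
      obtain ⟨k, hk⟩ := this
      exact (sdiff_nonempty.2 (hne k)).mono hk)
  have hx' : ∀ i, x ∈ D i \ E := fun i => hx _ ⟨i, rfl⟩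
  exact (hx' (Classical.arbitrary ι)).2 (h (mem_iInter.2 fun i => (hx' i).1))

end Saturation

/-! ### Points in an elementary substructure -/

section Points

variable {L : FirstOrder.Language.{u, v}} {R : Type w} {N : Type w'} [L.Structure R]
  [L.Structure N] (j : R ↪ₑ[L] N) {X₀ X Y₀ Y : Type*} {α β : Type}
  {c₀ : X₀ → α → R} {c : X → α → N} {d₀ : Y₀ → β → R} {d : Y → β → N}

/-- `ι` identifies `X₀` with the set of those points of `X` whose coordinates lie in the
elementary substructure `R`. -/
structure IsPoints (c₀ : X₀ → α → R) (c : X → α → N) (ι : X₀ → X) : Prop where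
  coord_apply : ∀ x, c (ι x) = j ∘ c₀ x
  mem_range : ∀ v : α → R, j ∘ v ∈ range c → v ∈ range c₀

variable {j} {ι : X₀ → X} {ι' : Y₀ → Y}

theorem IsPoints.prod (h : IsPoints j c₀ c ι) (h' : IsPoints j d₀ d ι') :
    IsPoints j (prodCoord c₀ d₀) (prodCoord c d) (Prod.map ι ι') := by
  refine ⟨fun p => ?_, fun v hv => ?_⟩
  · ext i
    rcases i with i | i
    · exact congrFun (h.1 p.1) i
    · exact congrFun (h'.1 p.2) i
  · obtain ⟨p, hp⟩ := hv
    obtain ⟨x, hx⟩ := h.2 (v ∘ Sum.inl) ⟨p.1, funext fun i => congrFun hp (Sum.inl i)⟩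
    obtain ⟨y, hy⟩ := h'.2 (v ∘ Sum.inr) ⟨p.2, funext fun i => congrFun hp (Sum.inr i)⟩
    refine ⟨(x, y), ?_⟩
    ext i
    rcases i with i | i
    · exact congrFun hx i
    · exact congrFun hy i

theorem IsPoints.coord_mem (h : IsPoints j c₀ c ι) (x : X₀) (i : α) : c (ι x) i ∈ range j := by
  rw [h.1]; exact ⟨_, rfl⟩

theorem exists_formula_of_definable_range {D : Set (α → N)} (hD : (range j).Definable L D) :
    ∃ φ : L.Formula (R ⊕ α), D = {v | φ.Realize (Sum.elim j v)} := by
  obtain ⟨φ, rfl⟩ := definable_iff_exists_formula_sum.1 hD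
  choose s hs using fun a : range j => a.2
  refine ⟨φ.relabel (Sum.map s id), ?_⟩
  ext v
  simp only [mem_ofPred_eq, Formula.realize_relabel, Sum.elim_comp_map, Function.comp_id]
  apply iff_of_eq
  congr 2
  exact funext fun a => (hs a).symm

theorem definable_range_of_formula (φ : L.Formula (R ⊕ α)) :
    (range j).Definable L {v : α → N | φ.Realize (Sum.elim j v)} := by
  rw [definable_iff_exists_formula_sum]
  refine ⟨φ.relabel (Sum.map (rangeFactorization j) id), ?_⟩
  ext v
  simp only [mem_ofPred_eq, Formula.realize_relabel, Sum.elim_comp_map, Function.comp_id]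
  rfl

theorem realize_iff_realize_comp (φ : L.Formula (R ⊕ α)) (v : α → R) :
    φ.Realize (Sum.elim j (j ∘ v)) ↔ φ.Realize (Sum.elim id v) := by
  rw [← j.map_formula, Sum.comp_elim, Function.comp_id]

/-- The trace on the elementary substructure of a set definable over it is definable. -/
theorem IsPoints.isDefinable_preimage (h : IsPoints j c₀ c ι) (hc : Function.Injective c)
    {D : Set X} (hD : IsDefinable L (range j) c D) : IsDefinable L univ c₀ (ι ⁻¹' D) := by
  obtain ⟨φ, hφ⟩ := exists_formula_of_definable_range hD
  rw [IsDefinable, definable_iff_exists_formula_sum]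
  refine ⟨φ.relabel (Sum.map (fun x => ⟨x, trivial⟩) id), ?_⟩
  ext v
  simp only [mem_ofPred_eq, Formula.realize_relabel, Sum.elim_comp_map, Function.comp_id]
  change _ ↔ φ.Realize (Sum.elim id v)
  rw [← realize_iff_realize_comp (j := j)]
  change _ ↔ j ∘ v ∈ {v | φ.Realize (Sum.elim j v)}
  rw [← hφ]
  constructor
  · rintro ⟨x, hx, rfl⟩
    exact ⟨ι x, hx, h.1 x⟩
  · rintro ⟨x, hx, hxv⟩
    obtain ⟨y, rfl⟩ := h.2 v ⟨x, hxv⟩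
    refine ⟨y, ?_, rfl⟩
    rw [mem_preimage, hc ((h.1 y).trans hxv.symm)]
    exact hx

/-- Every definable set of `R`-points is the trace of a set definable over `R`. -/
theorem IsPoints.exists_isDefinable (h : IsPoints j c₀ c ι) (hc₀ : Function.Injective c₀)
    (hc : IsCoord L (range j) c) {U : Set X₀} (hU : IsDefinable L univ c₀ U) :
    ∃ D : Set X, IsDefinable L (range j) c D ∧ ι ⁻¹' D = U := by
  obtain ⟨φ, hφ⟩ := definable_iff_exists_formula_sum.1 hU
  have hdef := definable_range_of_formula (j := j) (φ.relabel (Sum.map Subtype.val id))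
  refine ⟨c ⁻¹' {v | (φ.relabel (Sum.map Subtype.val id)).Realize (Sum.elim j v)}, ?_, ?_⟩
  · rw [IsDefinable, image_preimage_eq_inter_range]
    exact hdef.inter hc.2
  · ext x
    rw [mem_preimage, mem_preimage, h.1, mem_ofPred_eq, realize_iff_realize_comp,
      Formula.realize_relabel, Sum.elim_comp_map, Function.comp_id]
    change c₀ x ∈ {v | φ.Realize (Sum.elim Subtype.val v)} ↔ _
    rw [← hφ, hc₀.mem_set_image]

/-- A nonempty set definable over an elementary substructure has a point in it. -/
theorem IsPoints.exists_mem [Finite α] (h : IsPoints j c₀ c ι) (hc : Function.Injective c)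
    {D : Set X} (hD : IsDefinable L (range j) c D) (hne : D.Nonempty) : ∃ x, ι x ∈ D := by
  obtain ⟨φ, hφ⟩ := exists_formula_of_definable_range hD
  obtain ⟨y, hy⟩ := hne
  have hy' : φ.Realize (Sum.elim j (c y)) := hφ.subset ⟨y, hy, rfl⟩
  have h1 : (φ.iExs α).Realize (j ∘ id) := Formula.realize_iExs.2 ⟨c y, hy'⟩
  rw [j.map_formula, Formula.realize_iExs] at h1
  obtain ⟨v, hv⟩ := h1
  rw [← realize_iff_realize_comp (j := j)] at hv
  obtain ⟨x, hx, hxv⟩ := hφ.symm.subset hv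
  obtain ⟨z, rfl⟩ := h.2 v ⟨x, hxv⟩
  refine ⟨z, ?_⟩
  rwa [hc ((h.1 z).trans hxv.symm)]

end Points

/-! ### Counting definable sets -/

section Counting

variable {L : FirstOrder.Language.{u, v}} {R : Type w} {N : Type w'} [L.Structure R]
  [L.Structure N] {j : R ↪ₑ[L] N} {X : Type*} {α : Type} [Finite α] {κ : Cardinal.{w'}}

theorem IsMonster.card_range_lt (hN : IsMonster κ j) : #(range j) < κ := by
  rw [← Cardinal.lift_lt.{_, w}, Cardinal.mk_range_eq_of_injective j.injective]
  exact hN.card_model_lt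

/-- There are fewer than `κ` sets definable over `R`. -/
theorem IsMonster.card_definable_lt (hN : IsMonster κ j) :
    #{D : Set (α → N) // (range j).Definable L D} < κ := by
  classical
  let f : L.Formula (R ⊕ α) → {D : Set (α → N) // (range j).Definable L D} :=
    fun φ => ⟨_, definable_range_of_formula φ⟩
  have hf : Function.Surjective f := fun D => by
    obtain ⟨φ, hφ⟩ := exists_formula_of_definable_range D.2
    exact ⟨φ, Subtype.ext hφ.symm⟩
  have h1 : Cardinal.lift.{max u v w} #{D : Set (α → N) // (range j).Definable L D} ≤
      Cardinal.lift.{w'} #(L.Formula (R ⊕ α)) := Cardinal.lift_mk_le_lift_mk_of_surjective hf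
  have h2 : #(L.Formula (R ⊕ α)) ≤ #(Σ n, L.BoundedFormula (R ⊕ α) n) :=
    Cardinal.mk_le_of_injective (f := fun φ => ⟨0, φ⟩) fun _ _ h => by simpa using h
  have h3 := h2.trans BoundedFormula.card_le
  rw [← Cardinal.lift_lt.{_, max u v w}]
  refine (h1.trans (Cardinal.lift_le.2 h3)).trans_lt ?_
  have hκ : ℵ₀ ≤ Cardinal.lift.{max u v w} κ := by simpa using hN.aleph0_lt.le
  have hM := Cardinal.lift_lt.{_, max u v}.2 hN.card_model_lt
  have hL := Cardinal.lift_lt.{_, w}.2 hN.card_language_lt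
  simp only [Cardinal.lift_lift] at hM hL
  simp only [Cardinal.lift_max, Cardinal.lift_aleph0, Cardinal.lift_add, Cardinal.mk_sum,
    Cardinal.lift_lift, max_lt_iff]
  refine ⟨by simpa using hN.aleph0_lt, Cardinal.add_lt_of_lt hκ
    (Cardinal.add_lt_of_lt hκ ?_ ?_) ?_⟩
  · exact hM
  · refine lt_of_lt_of_le ?_ hκ
    simp
  · exact hL

end Counting

/-! ### Definable neighbourhoods of type-definable sets -/

section Envelope

variable {L : FirstOrder.Language.{u, v}} {M : Type w} [L.Structure M] {A A₁ A₂ B : Set M}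
  {X Y : Type*} {α β : Type} {c : X → α → M} {d : Y → β → M}
  {κ : Cardinal.{w}}

variable (L A) in
/-- The `A`-definable sets that contain `T`. -/
def envelopes (c : X → α → M) (T : Set X) : Set (Set X) := {D | IsDefinable L A c D ∧ T ⊆ D}

theorem IsCoord.univ_mem_envelopes (hc : IsCoord L A c) {T : Set X} : univ ∈ envelopes L A c T :=
  ⟨hc.isDefinable_univ, subset_univ _⟩

theorem inter_mem_envelopes (hc : Function.Injective c) {T D E : Set X}
    (hD : D ∈ envelopes L A c T) (hE : E ∈ envelopes L A c T) : D ∩ E ∈ envelopes L A c T :=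
  ⟨hD.1.inter hc hE.1, subset_inter hD.2 hE.2⟩

/-- Compactness for a product of type-definable sets. -/
theorem IsSaturated.exists_prod_subset [Finite α] [Finite β] (hM : IsSaturated L κ M)
    (hB : #B < κ) (h₁ : A₁ ⊆ B) (h₂ : A₂ ⊆ B) (hc : IsCoord L A₁ c) (hd : IsCoord L A₂ d) {T : Set X} {S : Set Y}
    (hT : IsTypeDefinable L A₁ c T) (hS : IsTypeDefinable L A₂ d S) {E : Set (X × Y)}
    (hE : IsDefinable L B (prodCoord c d) E) (h : T ×ˢ S ⊆ E) :
    ∃ D ∈ envelopes L A₁ c T, ∃ D' ∈ envelopes L A₂ d S, D ×ˢ D' ⊆ E := by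
  have hcB := hc.mono h₁
  have hdB := hd.mono h₂
  have : Nonempty (envelopes L A₁ c T × envelopes L A₂ d S) :=
    ⟨⟨_, hc.univ_mem_envelopes⟩, ⟨_, hd.univ_mem_envelopes⟩⟩
  obtain ⟨⟨D, D'⟩, hDE⟩ := hM.exists_subset_of_directed hB (hcB.prod hdB)
    (ι := envelopes L A₁ c T × envelopes L A₂ d S) (D := fun i => i.1.1 ×ˢ i.2.1) (E := E)
    (fun i => IsDefinable.inter (hcB.prod hdB).1
      ((i.1.2.1.mono h₁).preimage (hcB.prod hdB) hcB.1 .fst)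
      ((i.2.2.1.mono h₂).preimage (hcB.prod hdB) hdB.1 .snd)) hE
    (fun i i' => ⟨⟨⟨_, inter_mem_envelopes hc.1 i.1.2 i'.1.2⟩,
      ⟨_, inter_mem_envelopes hd.1 i.2.2 i'.2.2⟩⟩, by
        rintro ⟨x, y⟩ ⟨⟨h1, h2⟩, h3, h4⟩
        exact ⟨⟨h1, h3⟩, h2, h4⟩⟩)
    (by
      rintro ⟨x, y⟩ hxy
      rw [mem_iInter] at hxy
      apply h
      constructor
      · by_contra hx
        obtain ⟨D, hD, hTD, hxD⟩ := hc.isTypeDefinable_iff.1 hT _ hx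
        exact hxD (hxy ⟨⟨D, hD, hTD⟩, ⟨_, hd.univ_mem_envelopes⟩⟩).1
      · by_contra hy
        obtain ⟨D, hD, hTD, hyD⟩ := hd.isTypeDefinable_iff.1 hS _ hy
        exact hyD (hxy ⟨⟨_, hc.univ_mem_envelopes⟩, ⟨D, hD, hTD⟩⟩).2)
  exact ⟨D, D.2, D', D'.2, hDE⟩

/-- Compactness for two disjoint type-definable sets. -/
theorem IsSaturated.exists_disjoint [Finite α] (hM : IsSaturated L κ M) (hB : #B < κ)
    (h₁ : A₁ ⊆ B) (h₂ : A₂ ⊆ B) (hc₁ : IsCoord L A₁ c) (hc₂ : IsCoord L A₂ c) {T S : Set X}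
    (hT : IsTypeDefinable L A₁ c T) (hS : IsTypeDefinable L A₂ c S) (h : Disjoint T S) :
    ∃ D ∈ envelopes L A₁ c T, ∃ D' ∈ envelopes L A₂ c S, Disjoint D D' := by
  have : Nonempty (envelopes L A₁ c T × envelopes L A₂ c S) :=
    ⟨⟨_, hc₁.univ_mem_envelopes⟩, ⟨_, hc₂.univ_mem_envelopes⟩⟩
  obtain ⟨⟨D, D'⟩, hDE⟩ := hM.exists_subset_of_directed hB (hc₁.mono h₁)
    (ι := envelopes L A₁ c T × envelopes L A₂ c S) (D := fun i => i.1.1 ∩ i.2.1) (E := ∅)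
    (fun i => IsDefinable.inter hc₁.1 (i.1.2.1.mono h₁) (i.2.2.1.mono h₂)) isDefinable_empty
    (fun i i' => ⟨⟨⟨_, inter_mem_envelopes hc₁.1 i.1.2 i'.1.2⟩,
      ⟨_, inter_mem_envelopes hc₁.1 i.2.2 i'.2.2⟩⟩, by
        rintro x ⟨⟨h1, h2⟩, h3, h4⟩
        exact ⟨⟨h1, h3⟩, h2, h4⟩⟩)
    (by
      intro x hxy
      rw [mem_iInter] at hxy
      refine h.le_bot (show x ∈ T ∩ S from ⟨?_, ?_⟩)
      · by_contra hx
        obtain ⟨D, hD, hTD, hxD⟩ := hc₁.isTypeDefinable_iff.1 hT _ hx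
        exact hxD (hxy ⟨⟨D, hD, hTD⟩, ⟨_, hc₂.univ_mem_envelopes⟩⟩).1
      · by_contra hy
        obtain ⟨D, hD, hTD, hyD⟩ := hc₂.isTypeDefinable_iff.1 hS _ hy
        exact hyD (hxy ⟨⟨_, hc₁.univ_mem_envelopes⟩, ⟨D, hD, hTD⟩⟩).2)
  exact ⟨D, D.2, D', D'.2, disjoint_iff_inter_eq_empty.2 (subset_empty_iff.1 hDE)⟩

/-- Adding the coordinates of fewer than `κ` points to a small set of parameters. -/
def addCoords (A : Set M) (c : X → α → M) {I : Type*} (g : I → X) : Set M :=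
  A ∪ range fun p : I × α => c (g p.1) p.2

theorem subset_addCoords {I : Type*} {g : I → X} : A ⊆ addCoords A c g := subset_union_left

theorem coord_mem_addCoords {I : Type*} {g : I → X} (i : I) (a : α) :
    c (g i) a ∈ addCoords A c g := Or.inr ⟨(i, a), rfl⟩

theorem card_addCoords_lt [Finite α] (hκ : ℵ₀ < κ) (hA : #A < κ) {I : Type w} {g : I → X}
    (hI : #I < κ) :
    #(addCoords A c g : Set M) < κ := by
  refine (Cardinal.mk_union_le _ _).trans_lt (Cardinal.add_lt_of_lt hκ.le hA ?_)
  have h1 := Cardinal.mk_range_le_lift (f := fun p : I × α => c (g p.1) p.2)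
  rw [Cardinal.mk_prod] at h1
  simp only [Cardinal.lift_mul, Cardinal.lift_lift, Cardinal.lift_uzero] at h1
  refine lt_of_le_of_lt ?_ (Cardinal.mul_lt_of_lt hκ.le hI
    ((Cardinal.lift_lt_aleph0.2 (Cardinal.lt_aleph0_of_finite α)).trans hκ))
  simpa using h1

end Envelope

/-! ### Definable groups and their type-definable subgroups of bounded index -/

section Groups

variable {L : FirstOrder.Language.{u, v}}

/-- A group definable over `A`, in coordinates `c` in which multiplication and inversion are given
by terms. -/
structure IsDefGroup (L : FirstOrder.Language.{u, v}) {M : Type w} [L.Structure M] (A : Set M)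
    {G : Type*} [Group G] {α : Type} (c : G → α → M) : Prop where
  coord : IsCoord L A c
  mul : IsTermMap L A (prodCoord c c) c fun p => p.1 * p.2
  inv : IsTermMap L A c c fun x => x⁻¹

section

variable {M : Type w} [L.Structure M] {A B : Set M} {G X : Type*} [Group G] {α β : Type}
  {c : G → α → M} {d : X → β → M}

theorem IsDefGroup.mono (hG : IsDefGroup L A c) (h : A ⊆ B) : IsDefGroup L B c :=
  ⟨hG.1.mono h, hG.2.mono h, hG.3.mono h⟩

theorem IsTermMap.mul {f g : X → G} (hf : IsTermMap L A d c f) (hg : IsTermMap L A d c g)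
    (hG : IsDefGroup L A c) : IsTermMap L A d c fun x => f x * g x :=
  hG.mul.comp (hf.prodMk hg)

theorem IsTermMap.inv {f : X → G} (hf : IsTermMap L A d c f)
    (hG : IsDefGroup L A c) : IsTermMap L A d c fun x => (f x)⁻¹ :=
  hG.inv.comp hf

theorem IsDefGroup.isDefinable_translate (hG : IsDefGroup L A c) {g : G} (hg : ∀ i, c g i ∈ A)
    {D : Set G} (hD : IsDefinable L A c D) : IsDefinable L A c {x | g⁻¹ * x ∈ D} :=
  hD.preimage hG.coord hG.coord.1
    (IsTermMap.mul (IsTermMap.inv (.const hg) hG) .id hG : IsTermMap L A c c fun x => g⁻¹ * x)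

theorem IsDefGroup.inv_mem_envelopes (hG : IsDefGroup L A c) {H : Subgroup G} {D : Set G}
    (hD : D ∈ envelopes L A c (H : Set G)) : D⁻¹ ∈ envelopes L A c (H : Set G) :=
  ⟨hD.1.preimage hG.coord hG.coord.1 hG.inv, fun _ hx => hD.2 (H.inv_mem hx)⟩

theorem IsDefGroup.isTypeDefinable_comp00 (hG : IsDefGroup L A c) {κ : Cardinal} :
    IsTypeDefinable L A c (comp00 L A c κ : Set G) := by
  rw [comp00, Subgroup.coe_sInf]
  exact hG.coord.isTypeDefinable_iInter fun H => hG.coord.isTypeDefinable_iInter fun hH => hH.1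

/-- The preimage of a type-definable subgroup of bounded index under a homomorphism given by terms
is again such a subgroup. -/
theorem IsDefGroup.comap_mem_boundedTypeDefinable {G G' : Type w'} [Group G] [Group G']
    {c : G → α → M} {κ : Cardinal.{w'}}
    {d : G' → β → M} (hG : IsDefGroup L A c) (hd : IsCoord L A d) {f : G' →* G}
    (hf : IsTermMap L A d c f) {H : Subgroup G}
    (hH : H ∈ boundedTypeDefinable L A c κ) :
    H.comap f ∈ boundedTypeDefinable L A d κ := by
  refine ⟨hH.1.preimage hd hG.coord hf, (Cardinal.mk_le_of_injective
    (f := fun i : G' ⧸ H.comap f => ((f i.out : G) : G ⧸ H)) fun i i' h => ?_).trans_lt hH.2⟩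
  rw [← QuotientGroup.out_eq' i, ← QuotientGroup.out_eq' i', QuotientGroup.eq, Subgroup.mem_comap,
    map_mul, map_inv]
  exact QuotientGroup.eq.1 h

end

variable {R : Type w} {N : Type w'} [L.Structure R]
  [L.Structure N] {j : R ↪ₑ[L] N} {κ : Cardinal.{w'}} {G : Type w'} {G₀ : Type*} [Group G]
  [Group G₀] {α : Type} [Finite α] {c : G → α → N} {c₀ : G₀ → α → R} {ι : G₀ →* G}

theorem IsDefGroup.exists_inv_mul_mem {H : Subgroup G} {D : Set G}
    (hG : IsDefGroup L (range j) c) (hN : IsMonster κ j)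
    (hH : IsTypeDefinable L (range j) c (H : Set G))
    (hD : D ∈ envelopes L (range j) c (H : Set G)) :
    ∃ D' ∈ envelopes L (range j) c (H : Set G), ∀ x ∈ D', ∀ y ∈ D', x⁻¹ * y ∈ D := by
  obtain ⟨D₁, h₁, D₂, h₂, h⟩ := hN.saturated.exists_prod_subset hN.card_range_lt subset_rfl
    subset_rfl hG.coord hG.coord hH hH (E := {p | p.1⁻¹ * p.2 ∈ D})
    (hD.1.preimage (hG.coord.prod hG.coord) hG.coord.1
      (IsTermMap.mul (IsTermMap.inv .fst hG) .snd hG))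
    (by rintro ⟨x, y⟩ ⟨hx, hy⟩; exact hD.2 (H.mul_mem (H.inv_mem hx) hy))
  exact ⟨D₁ ∩ D₂, inter_mem_envelopes hG.coord.1 h₁ h₂, fun x hx y hy =>
    h (show (x, y) ∈ D₁ ×ˢ D₂ from ⟨hx.1, hy.2⟩)⟩

/-- By saturation, finitely many translates of a definable set containing a type-definable subgroup
of bounded index cover the group. -/
theorem IsDefGroup.exists_finset_cover {H : Subgroup G} {D : Set G}
    (hG : IsDefGroup L (range j) c) (hN : IsMonster κ j) (hH : #(G ⧸ H) < κ)
    (hD : D ∈ envelopes L (range j) c (H : Set G)) :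
    ∃ s : Finset G, ∀ x, ∃ g ∈ s, g⁻¹ * x ∈ D := by
  classical
  by_contra! hne
  let B := addCoords (range j) c (Quotient.out : G ⧸ H → G)
  have hB : #B < κ := card_addCoords_lt hN.aleph0_lt hN.card_range_lt hH
  have hGB : IsDefGroup L B c := hG.mono subset_addCoords
  obtain ⟨x, hx⟩ := hN.saturated.nonempty_iInter hB hGB.coord
    (D := fun i : G ⧸ H => {x | i.out⁻¹ * x ∈ D}ᶜ)
    (fun i => (hGB.isDefinable_translate (coord_mem_addCoords i)
      (hD.1.mono subset_addCoords)).compl hGB.coord)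
    (fun s => by
      obtain ⟨x, hx⟩ := hne (s.image Quotient.out)
      exact ⟨x, mem_iInter₂.2 fun i hi => hx _ (Finset.mem_image_of_mem _ hi)⟩)
  rw [mem_iInter] at hx
  exact hx (x : G ⧸ H) (hD.2 (QuotientGroup.eq.1 (QuotientGroup.out_eq' (x : G ⧸ H))))

/-- A definable set containing a type-definable subgroup of bounded index is generic, with
translates by points over the elementary substructure. -/
theorem IsDefGroup.exists_finset_points_cover {H : Subgroup G} {D : Set G}
    (hG : IsDefGroup L (range j) c) (hN : IsMonster κ j) (hι : IsPoints j c₀ c ι)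
    (hT : IsTypeDefinable L (range j) c (H : Set G)) (hH : #(G ⧸ H) < κ)
    (hD : D ∈ envelopes L (range j) c (H : Set G)) :
    ∃ s : Finset G₀, ∀ x, ∃ r ∈ s, (ι r)⁻¹ * x ∈ D := by
  obtain ⟨D', hD', hDD⟩ := hG.exists_inv_mul_mem hN hT hD
  obtain ⟨s, hs⟩ := hG.exists_finset_cover hN hH hD'
  by_contra! hne
  -- otherwise, by elementarity, there is a sequence of points over `R` of which no two lie in the
  -- same translate of `D'`, although finitely many such translates cover the group
  obtain ⟨f, -, hf⟩ := exists_seq_of_forall_finset_exists (fun _ : G₀ => True)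
    (fun r x => (ι r)⁻¹ * ι x ∉ D) fun F _ => by
      obtain ⟨x, hx⟩ := hne F
      obtain ⟨y, hy⟩ := hι.exists_mem hG.coord.1
        ((isDefinable_biUnion F.finite_toSet fun r _ =>
          hG.isDefinable_translate (hι.coord_mem r) hD.1).compl hG.coord) ⟨x, by simpa using hx⟩
      exact ⟨y, trivial, by simpa using hy⟩
  choose i hi hif using fun n => hs (ι (f n))
  obtain ⟨m, n, hmn, hi'⟩ := Finite.exists_ne_map_eq_of_infinite fun n => (⟨i n, hi n⟩ : s)
  have h : i m = i n := congrArg Subtype.val hi'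
  clear hi'
  wlog hlt : m < n generalizing m n
  · exact this n m hmn.symm h.symm (lt_of_le_of_ne (not_lt.1 hlt) hmn.symm)
  refine hf m n hlt ?_
  have := hDD _ (hif m) _ (hif n)
  rwa [h, mul_inv_rev, inv_inv, mul_assoc, mul_inv_cancel_left] at this

/-- Elements with the same type over the elementary substructure lie in the same coset of every
type-definable subgroup of bounded index. -/
theorem IsDefGroup.inv_mul_mem_of_sameType {H : Subgroup G}
    (hG : IsDefGroup L (range j) c) (hN : IsMonster κ j) (hι : IsPoints j c₀ c ι)
    (hT : IsTypeDefinable L (range j) c (H : Set G)) (hH : #(G ⧸ H) < κ) {x y : G}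
    (hxy : ∀ D, IsDefinable L (range j) c D → x ∈ D → y ∈ D) : x⁻¹ * y ∈ H := by
  by_contra hne
  obtain ⟨D, hD, hHD, hxD⟩ := hG.coord.isTypeDefinable_iff.1 hT _ hne
  obtain ⟨D', hD', hDD⟩ := hG.exists_inv_mul_mem hN hT ⟨hD, hHD⟩
  obtain ⟨s, hs⟩ := hG.exists_finset_points_cover hN hι hT hH hD'
  obtain ⟨r, -, hr⟩ := hs x
  have hr' : (ι r)⁻¹ * y ∈ D' :=
    hxy _ (hG.isDefinable_translate (hι.coord_mem r) hD'.1) hr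
  apply hxD
  have := hDD _ hr _ hr'
  rwa [mul_inv_rev, inv_inv, mul_assoc, mul_inv_cancel_left] at this

theorem IsMonster.card_lt_of_injective (hN : IsMonster κ j) {Y Q : Type w'} (hY : #Y < κ)
    {f : Q → Set Y} (hf : Function.Injective f) : #Q < κ := by
  refine (Cardinal.mk_le_of_injective hf).trans_lt ?_
  rw [Cardinal.mk_set]
  exact hN.strongLimit.isStrongPrelimit hY

/-- There are fewer than `κ` types over the elementary substructure. -/
theorem IsMonster.card_quotient_lt (hN : IsMonster κ j) (hc : Function.Injective c) {H : Subgroup G}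
    (h : ∀ x y : G, (∀ D, IsDefinable L (range j) c D → (x ∈ D ↔ y ∈ D)) → x⁻¹ * y ∈ H) :
    #(G ⧸ H) < κ := by
  refine hN.card_lt_of_injective (hN.card_definable_lt (α := α))
    (f := fun i : G ⧸ H => {D | c i.out ∈ D.1}) fun i i' hii => ?_
  rw [← QuotientGroup.out_eq' i, ← QuotientGroup.out_eq' i', QuotientGroup.eq]
  refine h _ _ fun D hD => ?_
  have := Set.ext_iff.1 hii ⟨c '' D, hD⟩
  simpa only [mem_ofPred_eq, hc.mem_set_image] using this

/-- The component `G^00` is itself type-definable of bounded index. -/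
theorem IsDefGroup.isLeast_comp00 (hG : IsDefGroup L (range j) c) (hN : IsMonster κ j)
    (hι : IsPoints j c₀ c ι) :
    IsLeast (boundedTypeDefinable L (range j) c κ) (comp00 L (range j) c κ) := by
  refine ⟨⟨hG.isTypeDefinable_comp00, hN.card_quotient_lt hG.coord.1 fun x y hxy => ?_⟩,
    fun H hH => sInf_le hH⟩
  rw [comp00, Subgroup.mem_sInf]
  exact fun H hH => hG.inv_mul_mem_of_sameType hN hι hH.1 hH.2 fun D hD => (hxy D hD).1

/-- The component `G^00` is normal: its normal core is type-definable, by quantifying over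
all conjugates, and of bounded index. -/
theorem IsDefGroup.comp00_normal (hG : IsDefGroup L (range j) c) (hN : IsMonster κ j)
    (hι : IsPoints j c₀ c ι) : (comp00 L (range j) c κ).Normal := by
  have hU := hG.isLeast_comp00 hN hι
  set U := comp00 L (range j) c κ
  have hcore : U.normalCore ∈ boundedTypeDefinable L (range j) c κ := by
    constructor
    · exact IsTypeDefinable.forall (T := {p : G × G | p.2 * p.1 * p.2⁻¹ ∈ U})
        (hU.1.1.preimage (hG.coord.prod hG.coord) hG.coord
          (IsTermMap.mul (IsTermMap.mul .snd .fst hG) (IsTermMap.inv .snd hG) hG))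
        hG.coord hG.coord
    · have h2 : #((G ⧸ U) × (G ⧸ U)) < κ := by
        rw [Cardinal.mk_prod, Cardinal.lift_id]
        exact Cardinal.mul_lt_of_lt hN.aleph0_lt.le hU.1.2 hU.1.2
      -- a coset of the core is determined by the graph of its action on `G ⧸ U`
      refine hN.card_lt_of_injective h2
        (f := fun i : G ⧸ U.normalCore =>
          range fun g : G => ((g : G ⧸ U), ((i.out * g : G) : G ⧸ U))) fun i i' hii => ?_
      rw [← QuotientGroup.out_eq' i, ← QuotientGroup.out_eq' i', QuotientGroup.eq]
      intro g
      obtain ⟨g', hg'⟩ := (Set.ext_iff.1 hii (((g⁻¹ : G) : G ⧸ U), ((i.out * g⁻¹ : G) : G ⧸ U))).1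
        ⟨g⁻¹, rfl⟩
      rw [Prod.mk.injEq, QuotientGroup.eq, QuotientGroup.eq] at hg'
      have := U.mul_mem (U.inv_mem hg'.2) hg'.1
      convert this using 1
      group
  rw [← le_antisymm U.normalCore_le (hU.2 hcore)]
  infer_instance

end Groups

/-! ### The logic topology on a bounded quotient -/

section LogicTopology

variable {L : FirstOrder.Language.{u, v}}

/-- `q : G → Q` is a surjective homomorphism onto a group of size `< κ` whose kernel is
`A`-type-definable. -/
structure IsBoundedQuotient (L : FirstOrder.Language.{u, v}) {M : Type w} [L.Structure M]
    (A : Set M) (κ : Cardinal.{w}) {G : Type*} [Group G] {α : Type} (c : G → α → M)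
    {Q : Type w} [Group Q] (q : G →* Q) : Prop where
  surjective : Function.Surjective q
  isTypeDefinable_ker : IsTypeDefinable L A c (q.ker : Set G)
  card_lt : #Q < κ

variable {R : Type w} {N : Type w'} [L.Structure R]
  [L.Structure N] {j : R ↪ₑ[L] N} {κ : Cardinal.{w'}} {G Q : Type w'} [Group G] [Group Q]
  {α : Type} {c : G → α → N} {q : G →* Q}

/-- One small set of parameters, containing representatives of all cosets, suffices to type-define
the preimages of all closed sets. This makes intersections of closed sets closed even if `κ` is
singular. -/
theorem IsBoundedQuotient.isTypeDefinable_of_forall (hQ : IsBoundedQuotient L (range j) κ c q)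
    (hG : IsDefGroup L (range j) c) {C : Set Q}
    (h : ∀ g, q g ∉ C → ∃ D ∈ envelopes L (range j) c (q.ker : Set G), ∀ x ∈ D, q (g * x) ∉ C) :
    IsTypeDefinable L (addCoords (range j) c (Function.surjInv hQ.surjective)) c (q ⁻¹' C) := by
  have hGB := hG.mono (subset_addCoords (c := c) (g := Function.surjInv hQ.surjective))
  rw [hGB.coord.isTypeDefinable_iff]
  intro x hx
  have hs := Function.surjInv_eq hQ.surjective (q x)
  obtain ⟨D, hD, hDC⟩ := h (Function.surjInv hQ.surjective (q x)) (by rwa [hs])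
  refine ⟨_, (hGB.isDefinable_translate (coord_mem_addCoords (q x))
    (hD.1.mono subset_addCoords)).compl hGB.coord, fun y hy hyD => ?_, fun h => h ?_⟩
  · refine hDC _ hyD ?_
    rwa [mul_inv_cancel_left]
  · refine hD.2 ?_
    rw [SetLike.mem_coe, MonoidHom.mem_ker, map_mul, map_inv, hs, inv_mul_cancel]

variable [Finite α]

theorem IsSaturated.exists_envelope_subset {M : Type w'} [L.Structure M] {X : Type*} {c : X → α → M}
    {A B : Set M} (hM : IsSaturated L κ M) (hB : #B < κ) (hAB : A ⊆ B)
    (hc : IsCoord L A c) {T E : Set X} (hT : IsTypeDefinable L A c T)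
    (hE : IsTypeDefinable L B c Eᶜ) (h : T ⊆ E) : ∃ D ∈ envelopes L A c T, D ⊆ E := by
  obtain ⟨D, hD, D', hD', hDD⟩ := hM.exists_disjoint hB hAB subset_rfl hc (hc.mono hAB) hT hE
    (disjoint_compl_right_iff_subset.2 h)
  exact ⟨D, hD, (disjoint_compl_right_iff_subset.1 (hDD.mono_right hD'.2))⟩

/-- A subset of a bounded quotient has a preimage that is type-definable over a small set if and
only if its complement is open for the images of the definable neighbourhoods of the kernel. -/
theorem IsBoundedQuotient.exists_isTypeDefinable_iff (hQ : IsBoundedQuotient L (range j) κ c q)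
    (hG : IsDefGroup L (range j) c) (hN : IsMonster κ j) {C : Set Q} :
    (∃ B : Set N, #B < κ ∧ IsTypeDefinable L B c (q ⁻¹' C)) ↔
      ∀ g, q g ∉ C → ∃ D ∈ envelopes L (range j) c (q.ker : Set G), ∀ x ∈ D, q (g * x) ∉ C := by
  refine ⟨?_, fun h => ⟨_, card_addCoords_lt hN.aleph0_lt hN.card_range_lt hQ.card_lt,
    hQ.isTypeDefinable_of_forall hG h⟩⟩
  rintro ⟨B, hB, hC⟩ g hg
  let B' := addCoords (range j ∪ B) c fun _ : PUnit.{w' + 1} => g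
  have hB' : #B' < κ := card_addCoords_lt hN.aleph0_lt ((Cardinal.mk_union_le _ _).trans_lt
    (Cardinal.add_lt_of_lt hN.aleph0_lt.le hN.card_range_lt hB))
    (by simpa using Cardinal.one_lt_aleph0.trans hN.aleph0_lt)
  have hjB : range j ⊆ B' := subset_union_left.trans subset_addCoords
  have hGB : IsDefGroup L B' c := hG.mono hjB
  obtain ⟨D, hD, hDE⟩ := hN.saturated.exists_envelope_subset hB' hjB hG.coord
    hQ.isTypeDefinable_ker (E := {x | q (g * x) ∉ C})
    (by
      have := (hC.mono (subset_union_right.trans subset_addCoords : B ⊆ B')).preimage hGB.coord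
        hGB.coord (IsTermMap.mul (.const fun i => coord_mem_addCoords PUnit.unit i) .id hGB :
          IsTermMap L B' c c fun x => g * x)
      convert this using 1
      ext x
      simp)
    (fun x hx => by
      rw [SetLike.mem_coe, MonoidHom.mem_ker] at hx
      rwa [mem_ofPred_eq, map_mul, hx, mul_one])
  exact ⟨D, hD, hDE⟩

/-- The images in a bounded quotient of the definable sets that contain the kernel, as a basis of
neighbourhoods of the identity. -/
@[reducible]
def IsBoundedQuotient.filterBasis (hQ : IsBoundedQuotient L (range j) κ c q)
    (hG : IsDefGroup L (range j) c) (hN : IsMonster κ j) : GroupFilterBasis Q where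
  sets := (q '' ·) '' envelopes L (range j) c (q.ker : Set G)
  nonempty := ⟨_, _, hG.coord.univ_mem_envelopes, rfl⟩
  inter_sets := by
    rintro _ _ ⟨D, hD, rfl⟩ ⟨D', hD', rfl⟩
    exact ⟨_, ⟨_, inter_mem_envelopes hG.coord.1 hD hD', rfl⟩, image_inter_subset _ _ _⟩
  one' := by
    rintro _ ⟨D, hD, rfl⟩
    exact ⟨1, hD.2 q.ker.one_mem, map_one q⟩
  mul' := by
    rintro _ ⟨D, hD, rfl⟩
    obtain ⟨E, hE, hED⟩ := hG.exists_inv_mul_mem hN hQ.isTypeDefinable_ker hD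
    refine ⟨_, ⟨_, inter_mem_envelopes hG.coord.1 hE (hG.inv_mem_envelopes hE), rfl⟩, ?_⟩
    rintro _ ⟨_, ⟨x, hx, rfl⟩, _, ⟨y, hy, rfl⟩, rfl⟩
    refine ⟨x * y, ?_, map_mul q x y⟩
    simpa using hED _ hx.2 _ hy.1
  inv' := by
    rintro _ ⟨D, hD, rfl⟩
    refine ⟨_, ⟨_, hG.inv_mem_envelopes hD, rfl⟩, ?_⟩
    rintro _ ⟨x, hx, rfl⟩
    exact ⟨x⁻¹, hx, map_inv q x⟩
  conj' := by
    rintro y _ ⟨D, hD, rfl⟩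
    obtain ⟨g, rfl⟩ := hQ.surjective y
    let B := addCoords (range j) c fun _ : PUnit.{w' + 1} => g
    have hB : #B < κ := card_addCoords_lt hN.aleph0_lt hN.card_range_lt
      (by simpa using Cardinal.one_lt_aleph0.trans hN.aleph0_lt)
    have hjB : range j ⊆ B := subset_addCoords
    have hGB : IsDefGroup L B c := hG.mono hjB
    have hg : ∀ i, c g i ∈ B := fun i => coord_mem_addCoords PUnit.unit i
    obtain ⟨E, hE, hED⟩ := hN.saturated.exists_envelope_subset hB hjB hG.coord
      hQ.isTypeDefinable_ker (E := {x | g * x * g⁻¹ ∈ D})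
      ((((hD.1.mono hjB).compl hGB.coord).preimage hGB.coord hGB.coord.1
        (IsTermMap.mul (IsTermMap.mul (.const hg) .id hGB) (IsTermMap.inv (.const hg) hGB) hGB :
          IsTermMap L B c c fun x => g * x * g⁻¹)).isTypeDefinable)
      (fun x hx => hD.2 ((MonoidHom.normal_ker q).conj_mem x hx g))
    refine ⟨_, ⟨E, hE, rfl⟩, ?_⟩
    rintro _ ⟨x, hx, rfl⟩
    exact ⟨_, hED hx, by simp⟩

theorem IsBoundedQuotient.isOpen_filterBasis_iff (hQ : IsBoundedQuotient L (range j) κ c q)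
    (hG : IsDefGroup L (range j) c) (hN : IsMonster κ j) {O : Set Q} :
    IsOpen[(hQ.filterBasis hG hN).topology] O ↔
      ∃ B : Set N, #B < κ ∧ IsTypeDefinable L B c (q ⁻¹' Oᶜ) := by
  let _ := (hQ.filterBasis hG hN).topology
  rw [hQ.exists_isTypeDefinable_iff hG hN, isOpen_iff_mem_nhds, hQ.surjective.forall]
  refine forall_congr' fun g => ?_
  rw [((hQ.filterBasis hG hN).nhds_hasBasis (q g)).mem_iff]
  simp only [mem_compl_iff, not_not]
  refine imp_congr_right fun _ => ⟨?_, ?_⟩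
  · rintro ⟨_, ⟨D, hD, rfl⟩, h⟩
    exact ⟨D, hD, fun x hx => h ⟨q x, ⟨x, hx, rfl⟩, (map_mul q g x).symm⟩⟩
  · rintro ⟨D, hD, h⟩
    refine ⟨_, ⟨D, hD, rfl⟩, ?_⟩
    rintro _ ⟨_, ⟨x, hx, rfl⟩, rfl⟩
    simpa using h x hx

theorem IsBoundedQuotient.logicTopology_eq (hQ : IsBoundedQuotient L (range j) κ c q)
    (hG : IsDefGroup L (range j) c) (hN : IsMonster κ j) :
    logicTopology L c κ q = (hQ.filterBasis hG hN).topology := by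
  let _ := (hQ.filterBasis hG hN).topology
  rw [logicTopology]
  simp_rw [← hQ.isOpen_filterBasis_iff hG hN]
  exact TopologicalSpace.generateFrom_setOfPred_isOpen _

theorem IsBoundedQuotient.isLogicTopology (hQ : IsBoundedQuotient L (range j) κ c q)
    (hG : IsDefGroup L (range j) c) (hN : IsMonster κ j) :
    IsLogicTopology L c κ q (logicTopology L c κ q) := fun C => by
  rw [hQ.logicTopology_eq hG hN]
  let _ := (hQ.filterBasis hG hN).topology
  rw [← isOpen_compl_iff, hQ.isOpen_filterBasis_iff hG hN, compl_compl]

theorem IsBoundedQuotient.mem_nhds_iff (hQ : IsBoundedQuotient L (range j) κ c q)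
    (hG : IsDefGroup L (range j) c) (hN : IsMonster κ j) {g : G} {O : Set Q} :
    O ∈ @nhds Q (logicTopology L c κ q) (q g) ↔
      ∃ D ∈ envelopes L (range j) c (q.ker : Set G), ∀ x ∈ D, q (g * x) ∈ O := by
  rw [hQ.logicTopology_eq hG hN, ((hQ.filterBasis hG hN).nhds_hasBasis (q g)).mem_iff]
  constructor
  · rintro ⟨_, ⟨D, hD, rfl⟩, h⟩
    exact ⟨D, hD, fun x hx => h ⟨q x, ⟨x, hx, rfl⟩, (map_mul q g x).symm⟩⟩
  · rintro ⟨D, hD, h⟩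
    refine ⟨_, ⟨D, hD, rfl⟩, ?_⟩
    rintro _ ⟨_, ⟨x, hx, rfl⟩, rfl⟩
    simpa using h x hx

theorem IsBoundedQuotient.isTopologicalGroup (hQ : IsBoundedQuotient L (range j) κ c q)
    (hG : IsDefGroup L (range j) c) (hN : IsMonster κ j) :
    @IsTopologicalGroup Q (logicTopology L c κ q) _ := by
  rw [hQ.logicTopology_eq hG hN]
  exact (hQ.filterBasis hG hN).isTopologicalGroup

theorem IsBoundedQuotient.t2Space (hQ : IsBoundedQuotient L (range j) κ c q)
    (hG : IsDefGroup L (range j) c) (hN : IsMonster κ j) :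
    @T2Space Q (logicTopology L c κ q) := by
  let _ := logicTopology L c κ q
  have := hQ.isTopologicalGroup hG hN
  rw [IsTopologicalGroup.t2Space_iff_one_closed, hQ.isLogicTopology hG hN]
  exact ⟨range j, hN.card_range_lt, hQ.isTypeDefinable_ker⟩

/-- Bounded quotients are compact: all closed sets have preimages type-definable over one small
set, so saturation applies. -/
theorem IsBoundedQuotient.compactSpace (hQ : IsBoundedQuotient L (range j) κ c q)
    (hG : IsDefGroup L (range j) c) (hN : IsMonster κ j) :
    @CompactSpace Q (logicTopology L c κ q) := by
  classical
  let _ := logicTopology L c κ q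
  refine compactSpace_of_finite_subfamily_closed fun {ι} Z hZ hempty => ?_
  by_contra! hne
  let B := addCoords (range j) c (Function.surjInv hQ.surjective)
  have hB : #B < κ := card_addCoords_lt hN.aleph0_lt hN.card_range_lt hQ.card_lt
  have hcB : IsCoord L B c := hG.coord.mono subset_addCoords
  have hZB : ∀ i, IsTypeDefinable L B c (q ⁻¹' Z i) := fun i =>
    hQ.isTypeDefinable_of_forall hG ((hQ.exists_isTypeDefinable_iff hG hN).1
      ((hQ.isLogicTopology hG hN (Z i)).1 (hZ i)))
  obtain ⟨x, hx⟩ := hN.saturated.nonempty_iInter hB hcB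
    (ι := Σ i, envelopes L B c (q ⁻¹' Z i)) (D := fun p => p.2.1) (fun p => p.2.2.1)
    (fun s => by
      obtain ⟨y, hy⟩ := hne (s.image Sigma.fst)
      obtain ⟨x, rfl⟩ := hQ.surjective y
      rw [mem_iInter₂] at hy
      exact ⟨x, mem_iInter₂.2 fun p hp => p.2.2.2 (hy _ (Finset.mem_image_of_mem _ hp))⟩)
  rw [mem_iInter] at hx
  refine (Set.ext_iff.1 hempty (q x)).1 (mem_iInter.2 fun i => ?_)
  by_contra hi
  obtain ⟨D, hD, hTD, hxD⟩ := hcB.isTypeDefinable_iff.1 (hZB i) x hi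
  exact hxD (hx ⟨i, D, hD, hTD⟩)

/-- Two bounded quotients with the same kernel are isomorphic, with their logic topologies. -/
theorem IsBoundedQuotient.exists_continuousMulEquiv {Q' : Type w'} [Group Q'] {q' : G →* Q'}
    (hQ : IsBoundedQuotient L (range j) κ c q) (hQ' : IsBoundedQuotient L (range j) κ c q')
    (hG : IsDefGroup L (range j) c) (hN : IsMonster κ j) (hker : q.ker = q'.ker) :
    letI := logicTopology L c κ q
    letI := logicTopology L c κ q'
    ∃ f : Q ≃ₜ* Q', ∀ g, f (q g) = q' g := by
  let _ := logicTopology L c κ q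
  let _ := logicTopology L c κ q'
  let f : Q →* Q' := q.liftOfSurjective hQ.surjective ⟨q', hker.le⟩
  have hf : ∀ g, f (q g) = q' g := fun g => MonoidHom.liftOfRightInverse_comp_apply _ _ _ _ g
  have hbij : Function.Bijective f := by
    refine ⟨(injective_iff_map_eq_one f).2 fun y hy => ?_, fun y => ?_⟩
    · obtain ⟨g, rfl⟩ := hQ.surjective y
      rw [hf] at hy
      exact hker.ge hy
    · obtain ⟨g, rfl⟩ := hQ'.surjective y
      exact ⟨q g, hf g⟩
  let f' := MulEquiv.ofBijective f hbij
  have hpre : ∀ C : Set Q', q ⁻¹' (f' ⁻¹' C) = q' ⁻¹' C := fun C => by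
    ext g
    change f (q g) ∈ C ↔ _
    rw [hf]
    rfl
  refine ⟨⟨f', continuous_iff_isClosed.2 fun C hC => ?_,
    continuous_iff_isClosed.2 fun C hC => ?_⟩, hf⟩
  · rw [hQ.isLogicTopology hG hN]
    rw [hQ'.isLogicTopology hG hN] at hC
    exact (hpre C).symm ▸ hC
  · rw [hQ'.isLogicTopology hG hN]
    rw [hQ.isLogicTopology hG hN] at hC
    rw [← hpre]
    convert hC using 5
    ext y
    simp

end LogicTopology

/-! ### Bounded quotients as definable compactifications -/

section Compactification

variable {L : FirstOrder.Language.{u, v}} {R : Type w} {N : Type w'} [L.Structure R]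
  [L.Structure N] {j : R ↪ₑ[L] N} {κ : Cardinal.{w'}} {G Q : Type w'} {G₀ : Type*} [Group G]
  [Group Q] [Group G₀] {α : Type} [Finite α] {c : G → α → N} {c₀ : G₀ → α → R} {ι : G₀ →* G}
  {q : G →* Q}

theorem IsBoundedQuotient.exists_finset_points_cover (hQ : IsBoundedQuotient L (range j) κ c q)
    (hG : IsDefGroup L (range j) c) (hN : IsMonster κ j) (hι : IsPoints j c₀ c ι) {D : Set G}
    (hD : D ∈ envelopes L (range j) c (q.ker : Set G)) :
    ∃ s : Finset G₀, ∀ x, ∃ r ∈ s, (ι r)⁻¹ * x ∈ D := by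
  refine hG.exists_finset_points_cover hN hι hQ.isTypeDefinable_ker ?_ hD
  rw [Cardinal.mk_congr (QuotientGroup.quotientKerEquivOfSurjective q hQ.surjective).toEquiv]
  exact hQ.card_lt

open Pointwise in
theorem IsBoundedQuotient.isDefinableCompactification
    (hQ : IsBoundedQuotient L (range j) κ c q)
    (hG : IsDefGroup L (range j) c) (hN : IsMonster κ j) (hι : IsPoints j c₀ c ι) :
    letI := logicTopology L c κ q
    IsDefinableCompactification L c₀ (q.comp ι) := by
  let _ := logicTopology L c κ q
  have hgrp := hQ.isTopologicalGroup hG hN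
  have hcomp := hQ.compactSpace hG hN
  refine ⟨hgrp, hcomp, hQ.t2Space hG hN, ?_, ?_⟩
  · intro y
    obtain ⟨g, rfl⟩ := hQ.surjective y
    rw [mem_closure_iff_nhds]
    intro O hO
    obtain ⟨D, hD, hDO⟩ := (hQ.mem_nhds_iff hG hN).1 hO
    obtain ⟨s, hs⟩ := hQ.exists_finset_points_cover hG hN hι (hG.inv_mem_envelopes hD)
    obtain ⟨r, -, hr⟩ := hs g
    refine ⟨q (ι r), ?_, r, rfl⟩
    rw [mem_inv, mul_inv_rev, inv_inv] at hr
    simpa using hDO _ hr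
  · intro C₁ C₂ h₁ h₂ hdisj
    obtain ⟨V, hV, hVC⟩ := compact_open_separated_mul_right h₁.isCompact h₂.isOpen_compl
      (subset_compl_iff_disjoint_right.2 hdisj)
    rw [← map_one q, hQ.mem_nhds_iff hG hN] at hV
    obtain ⟨D, hD, hDV⟩ := hV
    obtain ⟨E, hE, hED⟩ := hG.exists_inv_mul_mem hN hQ.isTypeDefinable_ker hD
    obtain ⟨s, hs⟩ := hQ.exists_finset_points_cover hG hN hι hE
    -- the union of the translates of `E` that meet the preimage of `C₁`
    let U : Set G := ⋃ r ∈ {r ∈ (s : Set G₀) | ∃ x, (ι r)⁻¹ * x ∈ E ∧ q x ∈ C₁},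
      {x | (ι r)⁻¹ * x ∈ E}
    have hU : IsDefinable L (range j) c U :=
      isDefinable_biUnion (s.finite_toSet.subset fun r hr => hr.1)
        fun r _ => hG.isDefinable_translate (hι.coord_mem r) hE.1
    refine ⟨ι ⁻¹' U, ι ⁻¹' Uᶜ, hι.isDefinable_preimage hG.coord.1 hU,
      hι.isDefinable_preimage hG.coord.1 (hU.compl hG.coord),
      disjoint_compl_right.preimage _, fun r hr => ?_, fun r hr hrU => ?_⟩
    · obtain ⟨r', hr', h⟩ := hs (ι r)
      exact mem_biUnion (show r' ∈ {r ∈ (s : Set G₀) | ∃ x, (ι r)⁻¹ * x ∈ E ∧ q x ∈ C₁} from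
        ⟨hr', ι r, h, hr⟩) h
    · simp only [U, mem_iUnion] at hrU
      obtain ⟨r', ⟨-, x, hxE, hxC⟩, hE'⟩ := hrU
      have h1 := hDV _ (hED _ hxE _ hE')
      rw [mul_inv_rev, inv_inv, mul_assoc, mul_inv_cancel_left, one_mul, map_mul, map_inv] at h1
      refine hVC (mul_mem_mul hxC h1) ?_
      rw [mul_inv_cancel_left]
      exact hr

end Compactification

/-! ### The universal property -/

section Universal

variable {L : FirstOrder.Language.{u, v}} {R : Type w} {N : Type w'} [L.Structure R]
  [L.Structure N] {j : R ↪ₑ[L] N}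

section TypeFilter

variable {X₀ X Y₀ Y : Type*} {α β : Type}
  {c₀ : X₀ → α → R} {c : X → α → N} {d₀ : Y₀ → β → R} {d : Y → β → N} {ι : X₀ → X} {ι' : Y₀ → Y}

/-- The filter on the set of `R`-points generated by the traces of the `R`-definable sets that
contain `x`, that is, by the type of `x` over `R`. -/
def typeFilter (hc : IsCoord L (range j) c) (ι : X₀ → X) (x : X) : Filter X₀ where
  sets := {S | ∃ D, IsDefinable L (range j) c D ∧ x ∈ D ∧ ι ⁻¹' D ⊆ S}
  univ_sets := ⟨univ, hc.isDefinable_univ, trivial, subset_univ _⟩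
  sets_of_superset := fun ⟨D, h, hx, hD⟩ h' => ⟨D, h, hx, hD.trans h'⟩
  inter_sets := fun ⟨D, h, hx, hD⟩ ⟨D', h', hx', hD'⟩ =>
    ⟨D ∩ D', h.inter hc.1 h', ⟨hx, hx'⟩, inter_subset_inter hD hD'⟩

theorem mem_typeFilter {hc : IsCoord L (range j) c} {x : X} {S : Set X₀} :
    S ∈ typeFilter hc ι x ↔ ∃ D, IsDefinable L (range j) c D ∧ x ∈ D ∧ ι ⁻¹' D ⊆ S := Iff.rfl

theorem IsPoints.typeFilter_neBot [Finite α] (hι : IsPoints j c₀ c ι) (hc : IsCoord L (range j) c)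
    (x : X) : (typeFilter hc ι x).NeBot := by
  rw [Filter.neBot_iff]
  intro h
  obtain ⟨D, hD, hx, hD'⟩ := Filter.empty_mem_iff_bot.2 h
  obtain ⟨y, hy⟩ := hι.exists_mem hc.1 hD ⟨x, hx⟩
  exact hD' hy

theorem pure_le_typeFilter (hc : IsCoord L (range j) c) (x : X₀) :
    pure x ≤ typeFilter hc ι (ι x) := by
  rintro S ⟨D, -, hx, hD⟩
  exact hD hx

theorem IsTermMap.tendsto_typeFilter (hc : IsCoord L (range j) c) (hd : IsCoord L (range j) d)
    {f : X → Y} {f₀ : X₀ → Y₀} (hf : IsTermMap L (range j) c d f) (h : ∀ x, ι' (f₀ x) = f (ι x))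
    (x : X) : Filter.Tendsto f₀ (typeFilter hc ι x) (typeFilter hd ι' (f x)) := by
  rintro S ⟨D, hD, hx, hDS⟩
  refine ⟨f ⁻¹' D, hD.preimage hc hd.1 hf, hx, fun y hy => hDS ?_⟩
  rw [mem_preimage, h]
  exact hy

end TypeFilter

variable {κ : Cardinal.{w'}} {G Q : Type w'} {G₀ : Type*} [Group G]
  [Group Q] [Group G₀] {α : Type} [Finite α] {c : G → α → N} {c₀ : G₀ → α → R} {ι : G₀ →* G}
  {q : G →* Q} {K : Type*} [Group K] [TopologicalSpace K] {φ : G₀ →* K}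

/-- A definable compactification converges along every type over `R`: two limit points would be
separated by closed neighbourhoods, hence by definable sets, only one of which is in the type. -/
theorem IsDefinableCompactification.exists_tendsto (hφ : IsDefinableCompactification L c₀ φ)
    (hc₀ : Function.Injective c₀) (hc : IsCoord L (range j) c) (hι : IsPoints j c₀ c ι) (x : G) :
    ∃ p, Filter.Tendsto φ (typeFilter hc ι x) (𝓝 p) := by
  have := hφ.compact
  have := hφ.hausdorff
  have := hι.typeFilter_neBot hc x
  obtain ⟨p, hp⟩ := exists_clusterPt_of_compactSpace (Filter.map φ (typeFilter hc ι x))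
  refine ⟨p, le_nhds_of_unique_clusterPt fun p' hp' => ?_⟩
  by_contra hne
  obtain ⟨s, hs, s', hs', hd⟩ := exists_nhds_disjoint_closure hne
  obtain ⟨U, U', hU, hU', hUU, hsU, hsU'⟩ :=
    hφ.definable _ _ isClosed_closure isClosed_closure hd
  have key : ∀ {p s U}, ClusterPt p (Filter.map φ (typeFilter hc ι x)) → s ∈ 𝓝 p →
      IsDefinable L univ c₀ U → φ ⁻¹' closure s ⊆ U →
      ∃ D, IsDefinable L (range j) c D ∧ ι ⁻¹' D = U ∧ x ∈ D := by
    intro p s U hp hs hU hsU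
    obtain ⟨D, hD, rfl⟩ := hι.exists_isDefinable hc₀ hc hU
    refine ⟨D, hD, rfl, ?_⟩
    by_contra hx
    obtain ⟨_, hy, y, hyD, rfl⟩ := clusterPt_iff_nonempty.1 hp hs
      (Filter.image_mem_map (mem_typeFilter.2 ⟨Dᶜ, hD.compl hc, hx, subset_rfl⟩))
    exact hyD (hsU (subset_closure hy))
  obtain ⟨D, hD, rfl, hx⟩ := key hp' hs hU hsU
  obtain ⟨D', hD', rfl, hx'⟩ := key hp hs' hU' hsU'
  obtain ⟨y, hy, hy'⟩ := hι.exists_mem hc.1 (hD.inter hc.1 hD') ⟨x, hx, hx'⟩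
  exact hUU.le_bot ⟨hy, hy'⟩

/-- A definable compactification of the group of `R`-points extends to the whole group: the
extension is a homomorphism, closed sets have type-definable preimages, and its kernel has bounded
index. -/
theorem IsDefinableCompactification.exists_extension (hφ : IsDefinableCompactification L c₀ φ)
    (hc₀ : Function.Injective c₀) (hG : IsDefGroup L (range j) c) (hN : IsMonster κ j)
    (hι : IsPoints j c₀ c ι) :
    ∃ F : G →* K, (∀ r, F (ι r) = φ r) ∧
      (∀ C, IsClosed C → IsTypeDefinable L (range j) c (F ⁻¹' C)) ∧
      F.ker ∈ boundedTypeDefinable L (range j) c κ := by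
  have := hφ.compact
  have := hφ.hausdorff
  have := hφ.topologicalGroup
  have hne := hι.typeFilter_neBot hG.coord
  choose F hF using hφ.exists_tendsto hc₀ hG.coord hι
  -- compare the two limits along the type of the pair `(x, y)`
  have hmul : ∀ x y, F (x * y) = F x * F y := fun x y => by
    have := (hι.prod hι).typeFilter_neBot (hG.coord.prod hG.coord) (x, y)
    have h1 : Filter.Tendsto (fun p : G₀ × G₀ => φ (p.1 * p.2))
        (typeFilter (hG.coord.prod hG.coord) (Prod.map ι ι) (x, y)) (𝓝 (F (x * y))) :=
      (hF _).comp (hG.mul.tendsto_typeFilter (hG.coord.prod hG.coord) hG.coord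
        (fun p => map_mul ι p.1 p.2) (x, y))
    have h2 : Filter.Tendsto (fun p : G₀ × G₀ => φ p.1 * φ p.2)
        (typeFilter (hG.coord.prod hG.coord) (Prod.map ι ι) (x, y)) (𝓝 (F x * F y)) :=
      ((hF _).comp (IsTermMap.fst.tendsto_typeFilter (hG.coord.prod hG.coord) hG.coord
        (ι := Prod.map ι ι) (f₀ := Prod.fst) (fun p => rfl) (x, y))).mul
      ((hF _).comp (IsTermMap.snd.tendsto_typeFilter (hG.coord.prod hG.coord) hG.coord
        (ι := Prod.map ι ι) (f₀ := Prod.snd) (fun p => rfl) (x, y)))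
    simp_rw [map_mul] at h1
    exact tendsto_nhds_unique h1 h2
  have hclosed : ∀ C, IsClosed C → IsTypeDefinable L (range j) c (F ⁻¹' C) := fun C hC => by
    rw [hG.coord.isTypeDefinable_iff]
    intro x hx
    obtain ⟨V, hV, hVc, hVC⟩ := exists_mem_nhds_isClosed_subset (hC.isOpen_compl.mem_nhds hx)
    obtain ⟨D, hD, hxD, hDV⟩ := hF x hV
    refine ⟨Dᶜ, hD.compl hG.coord, fun y hy hyD => hVC ?_ hy, fun h => h hxD⟩
    exact hVc.mem_of_tendsto (hF y) (mem_typeFilter.2 ⟨D, hD, hyD, hDV⟩)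
  refine ⟨MonoidHom.mk' F hmul, fun r => ?_, hclosed, ?_, ?_⟩
  · exact tendsto_nhds_unique ((hF (ι r)).mono_left (pure_le_typeFilter hG.coord r))
      (tendsto_pure_nhds φ r)
  · exact hclosed {1} isClosed_singleton
  · refine hN.card_quotient_lt hG.coord.1 fun x y hxy => ?_
    have : typeFilter hG.coord ι x = typeFilter hG.coord ι y := by
      ext S
      exact exists_congr fun D => and_congr_right fun hD => by rw [hxy D hD]
    have h1 : F x = F y := tendsto_nhds_unique (hF x) (this ▸ hF y)
    rw [MonoidHom.mem_ker, map_mul, map_inv]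
    change (F x)⁻¹ * F y = 1
    rw [h1, inv_mul_cancel]

/-- The quotient by the smallest type-definable subgroup of bounded index is the definable Bohr
compactification of the group of `R`-points. -/
theorem IsBoundedQuotient.isDefinableBohr (hQ : IsBoundedQuotient L (range j) κ c q)
    (hker : q.ker = comp00 L (range j) c κ)
    (hG : IsDefGroup L (range j) c) (hN : IsMonster κ j) (hι : IsPoints j c₀ c ι)
    (hc₀ : Function.Injective c₀) :
    letI := logicTopology L c κ q
    IsDefinableBohr.{u, v, w, t} L c₀ (q.comp ι) := by
  let _ := logicTopology L c κ q
  have hcpt := hQ.isDefinableCompactification hG hN hι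
  refine ⟨hcpt, fun K _ _ φ hφ => ?_⟩
  have := hφ.hausdorff
  obtain ⟨F, hFι, hFC, hFker⟩ := hφ.exists_extension hc₀ hG hN hι
  let f := q.liftOfSurjective hQ.surjective ⟨F, hker.trans_le (sInf_le hFker)⟩
  have hf : ∀ x, f (q x) = F x := fun x => MonoidHom.liftOfRightInverse_comp_apply _ _ _ _ x
  have hfcont : Continuous f := continuous_iff_isClosed.2 fun C hC => by
    rw [hQ.isLogicTopology hG hN]
    refine ⟨range j, hN.card_range_lt, ?_⟩
    convert hFC C hC using 1
    ext x
    simp [hf]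
  refine ⟨⟨f, hfcont⟩, fun r => ?_, fun f' hf' => ?_⟩
  · exact (hFι r).symm.trans (hf _).symm
  · refine DFunLike.coe_injective (hcpt.dense.equalizer f'.continuous_toFun hfcont ?_)
    ext r
    exact (hf' r).symm.trans ((hFι r).symm.trans (hf _).symm)

end Universal

/-! ### Term functions on rings -/

section RingTerms

variable {L : FirstOrder.Language.{u, v}} {N : Type w} [L.Structure N] {A : Set N}
  {X : Type*} {α : Type} {c : X → α → N} {n : ℕ}

variable (L A) in
/-- In coordinates, the function `f : X → N` is given by an `L`-term with parameters from `A`. -/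
def IsTermFun (c : X → α → N) (f : X → N) : Prop :=
  ∃ s : L.Term (A ⊕ α), ∀ x, s.realize (Sum.elim (↑) (c x)) = f x

theorem IsTermFun.coord (i : α) : IsTermFun L A c fun x => c x i :=
  ⟨Term.var (Sum.inr i), fun _ => rfl⟩

theorem IsTermFun.definable_eq {f g : (α → N) → N} (hf : IsTermFun L A id f)
    (hg : IsTermFun L A id g) : A.Definable L {v | f v = g v} := by
  obtain ⟨s, hs⟩ := hf
  obtain ⟨r, hr⟩ := hg
  rw [definable_iff_exists_formula_sum]
  refine ⟨s.equal r, ?_⟩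
  ext v
  rw [mem_ofPred_eq, mem_ofPred_eq, Formula.realize_equal]
  exact (congrArg₂ (· = ·) (hs v) (hr v)).symm.to_iff

variable [Ring N] [CompatibleRing N] {f g : X → N}

theorem IsTermFun.zero (e : FirstOrder.Language.ring →ᴸ L) [e.IsExpansionOn N] :
    IsTermFun L A c fun _ => (0 : N) :=
  ⟨Constants.term (e.onFunction zeroFunc), fun x => by
    rw [Term.realize_constants]
    change Structure.funMap _ _ = _
    rw [LHom.map_onFunction, CompatibleRing.funMap_zero]⟩

theorem IsTermFun.one (e : FirstOrder.Language.ring →ᴸ L) [e.IsExpansionOn N] :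
    IsTermFun L A c fun _ => (1 : N) :=
  ⟨Constants.term (e.onFunction oneFunc), fun x => by
    rw [Term.realize_constants]
    change Structure.funMap _ _ = _
    rw [LHom.map_onFunction, CompatibleRing.funMap_one]⟩

theorem IsTermFun.add (e : FirstOrder.Language.ring →ᴸ L) [e.IsExpansionOn N]
    (hf : IsTermFun L A c f) (hg : IsTermFun L A c g) : IsTermFun L A c fun x => f x + g x := by
  obtain ⟨s, hs⟩ := hf
  obtain ⟨r, hr⟩ := hg
  refine ⟨Functions.apply₂ (e.onFunction addFunc) s r, fun x => ?_⟩
  rw [Term.realize_functions_apply₂, LHom.map_onFunction, hs, hr]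
  simp

theorem IsTermFun.mul (e : FirstOrder.Language.ring →ᴸ L) [e.IsExpansionOn N]
    (hf : IsTermFun L A c f) (hg : IsTermFun L A c g) : IsTermFun L A c fun x => f x * g x := by
  obtain ⟨s, hs⟩ := hf
  obtain ⟨r, hr⟩ := hg
  refine ⟨Functions.apply₂ (e.onFunction mulFunc) s r, fun x => ?_⟩
  rw [Term.realize_functions_apply₂, LHom.map_onFunction, hs, hr]
  simp

theorem IsTermFun.neg (e : FirstOrder.Language.ring →ᴸ L) [e.IsExpansionOn N]
    (hf : IsTermFun L A c f) : IsTermFun L A c fun x => -f x := by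
  obtain ⟨s, hs⟩ := hf
  refine ⟨Functions.apply₁ (e.onFunction negFunc) s, fun x => ?_⟩
  rw [Term.realize_functions_apply₁, LHom.map_onFunction, hs]
  simp

theorem IsTermFun.sum (e : FirstOrder.Language.ring →ᴸ L) [e.IsExpansionOn N] {I : Type*}
    (s : Finset I) {f : I → X → N} (hf : ∀ i, IsTermFun L A c (f i)) :
    IsTermFun L A c fun x => ∑ i ∈ s, f i x := by
  classical
  induction s using Finset.induction_on with
  | empty => simpa using IsTermFun.zero e
  | insert i s hi ih => simpa only [Finset.sum_insert hi] using (hf i).add e ih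

theorem IsTermFun.matrix_mul (e : FirstOrder.Language.ring →ᴸ L) [e.IsExpansionOn N]
    {F F' : X → Matrix (Fin n) (Fin n) N}
    (hF : ∀ i k, IsTermFun L A c fun x => F x i k) (hF' : ∀ i k, IsTermFun L A c fun x => F' x i k)
    (i k : Fin n) : IsTermFun L A c fun x => (F x * F' x) i k := by
  simp_rw [Matrix.mul_apply]
  exact IsTermFun.sum e _ fun l => (hF i l).mul e (hF' l k)

theorem IsTermFun.matrix_one (e : FirstOrder.Language.ring →ᴸ L) [e.IsExpansionOn N]
    (i k : Fin n) : IsTermFun L A c fun _ => (1 : Matrix (Fin n) (Fin n) N) i k := by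
  by_cases h : i = k
  · simpa [Matrix.one_apply, h] using IsTermFun.one e
  · simpa [Matrix.one_apply, h] using IsTermFun.zero e

theorem IsTermFun.matrix_pow (e : FirstOrder.Language.ring →ᴸ L) [e.IsExpansionOn N]
    {F : X → Matrix (Fin n) (Fin n) N} (hF : ∀ i k, IsTermFun L A c fun x => F x i k) (m : ℕ)
    (i k : Fin n) : IsTermFun L A c fun x => (F x ^ m) i k := by
  induction m generalizing i k with
  | zero => simpa only [pow_zero] using IsTermFun.matrix_one e i k
  | succ m ih => simpa only [pow_succ] using IsTermFun.matrix_mul e ih hF i k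

end RingTerms

/-! ### The additive group and the unitriangular groups as definable groups -/

section RingGroups

variable {L : FirstOrder.Language.{u, v}}

section

variable {N : Type w} [L.Structure N] [Ring N] {A : Set N} {n : ℕ}

/-- The coordinate map of the additive group of a ring, written multiplicatively. -/
abbrev addCoord (S : Type*) : Multiplicative S → Fin 1 → S := fun x => ringCoord S x.toAdd

theorem isCoord_ringCoord {N : Type w} [L.Structure N] {A : Set N} :
    IsCoord L A (ringCoord N) := by
  refine ⟨fun x y h => congrFun h 0, ?_⟩
  have : range (ringCoord N) = univ := eq_univ_of_forall fun v =>
    ⟨v 0, funext fun i => congrArg v (Subsingleton.elim _ _)⟩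
  rw [this]
  exact definable_univ

theorem isDefGroup_addCoord [CompatibleRing N]
    (e : FirstOrder.Language.ring →ᴸ L) [e.IsExpansionOn N] : IsDefGroup L A (addCoord N) :=
  ⟨isCoord_ringCoord,
    fun _ => (IsTermFun.coord (Sum.inl 0)).add e (IsTermFun.coord (Sum.inr 0)),
    fun _ => (IsTermFun.coord 0).neg e⟩

theorem isDefGroup_utCoord [CompatibleRing N]
    (e : FirstOrder.Language.ring →ᴸ L) [e.IsExpansionOn N] : IsDefGroup L A (utCoord n N) := by
  have hcoord : ∀ i k, IsTermFun L A (utCoord n N)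
      fun x => (x : Matrix (Fin n) (Fin n) N) i k := fun i k => IsTermFun.coord (i, k)
  refine ⟨⟨fun x y h => Subtype.ext (Matrix.ext fun i k => congrFun h (i, k)), ?_⟩, ?_, ?_⟩
  · have : range (utCoord n N) = (⋂ p : Fin n × Fin n, {v | p.2 < p.1 → v p = 0}) ∩
        ⋂ i, {v | v (i, i) = 1} := by
      ext v
      simp only [mem_inter_iff, mem_iInter, mem_ofPred_eq]
      constructor
      · rintro ⟨a, rfl⟩
        exact ⟨fun p => a.2.1 p.1 p.2, a.2.2⟩
      · exact fun h => ⟨⟨fun i k => v (i, k), fun i k => h.1 (i, k), h.2⟩, rfl⟩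
    rw [this]
    refine (definable_iInter_of_finite fun p => ?_).inter (definable_iInter_of_finite fun i =>
      IsTermFun.definable_eq (.coord (c := id) _) (.one e))
    by_cases h : p.2 < p.1
    · simpa only [h, true_imp_iff, id] using
        IsTermFun.definable_eq (.coord (c := id) p) (.zero (A := A) e)
    · simp [h]
  · rintro ⟨i, k⟩
    exact IsTermFun.matrix_mul e (c := prodCoord (utCoord n N) (utCoord n N))
      (F := fun x => x.1.1) (F' := fun x => x.2.1)
      (fun i k => IsTermFun.coord (Sum.inl (i, k))) (fun i k => IsTermFun.coord (Sum.inr (i, k))) i k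
  · rintro ⟨i, k⟩
    have : IsTermFun L A (utCoord n N) fun x =>
        ∑ m ∈ Finset.range n, ((1 - (x : Matrix (Fin n) (Fin n) N)) ^ m) i k := by
      refine IsTermFun.sum e _ fun m => IsTermFun.matrix_pow e (fun i k => ?_) m i k
      simp_rw [Matrix.sub_apply, sub_eq_add_neg]
      exact (IsTermFun.matrix_one e i k).add e ((hcoord i k).neg e)
    simp_rw [← Matrix.sum_apply] at this
    exact this

theorem isTermMap_mul [CompatibleRing N]
    (e : FirstOrder.Language.ring →ᴸ L) [e.IsExpansionOn N] :
    IsTermMap L A (prodCoord (ringCoord N) (ringCoord N)) (ringCoord N) fun p => p.1 * p.2 :=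
  fun _ => (IsTermFun.coord (Sum.inl 0)).mul e (IsTermFun.coord (Sum.inr 0))

theorem isTermMap_entry (i k : Fin n) : IsTermMap L A (utCoord n N) (ringCoord N)
    fun x => (x : Matrix (Fin n) (Fin n) N) i k :=
  fun _ => IsTermFun.coord (i, k)

end

variable {R : Type w} {N : Type w'} [Ring R] [Ring N] [CompatibleRing R] [CompatibleRing N]
  [L.Structure R] [L.Structure N] (e : FirstOrder.Language.ring →ᴸ L) [e.IsExpansionOn R]
  [e.IsExpansionOn N] (j : R ↪ₑ[L] N) {n : ℕ}

theorem isPoints_addCoord : IsPoints j (addCoord R) (addCoord N)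
    (AddMonoidHom.toMultiplicative (elemRingHom e j).toAddMonoidHom) :=
  ⟨fun _ => rfl, fun v _ => ⟨Multiplicative.ofAdd (v 0),
    funext fun _ => congrArg v (Subsingleton.elim _ _)⟩⟩

theorem isPoints_utCoord : IsPoints j (utCoord n R) (utCoord n N)
    (UT.map (elemRingHom e j)) := by
  refine ⟨fun _ => rfl, fun v hv => ?_⟩
  obtain ⟨a, ha⟩ := hv
  have ha' : ∀ i k, (a : Matrix (Fin n) (Fin n) N) i k = elemRingHom e j (v (i, k)) :=
    fun i k => congrFun ha (i, k)
  have hinj : Function.Injective (elemRingHom e j) := j.injective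
  refine ⟨⟨fun i k => v (i, k), fun i k h => hinj ?_, fun i => hinj ?_⟩, rfl⟩
  · rw [← ha', a.2.1 i k h, map_zero]
  · rw [← ha', a.2.2 i, map_one]

end RingGroups

/-! ### Components of the additive group -/

section Additive

variable {L : FirstOrder.Language.{u, v}} {N : Type w'} [Ring N] [L.Structure N] {A : Set N}
  {κ : Cardinal.{w'}}

theorem mem_addBoundedTypeDefinable_iff {H : AddSubgroup N} :
    H ∈ addBoundedTypeDefinable L A (ringCoord N) κ ↔
      AddSubgroup.toSubgroup H ∈ boundedTypeDefinable L A (addCoord N) κ := by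
  have : #(N ⧸ H) = #(Multiplicative N ⧸ AddSubgroup.toSubgroup H) :=
    Cardinal.mk_congr (Quotient.congr Multiplicative.ofAdd fun a b => by
      rw [QuotientAddGroup.leftRel_apply, QuotientGroup.leftRel_apply]
      rfl)
  refine and_congr Iff.rfl ?_
  rw [this]

theorem isLeast_addComp00 (h : IsLeast (boundedTypeDefinable L A (addCoord N) κ)
    (comp00 L A (addCoord N) κ)) :
    IsLeast (addBoundedTypeDefinable L A (ringCoord N) κ) (addComp00 L A (ringCoord N) κ) ∧
      AddSubgroup.toSubgroup (addComp00 L A (ringCoord N) κ) = comp00 L A (addCoord N) κ := by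
  have h' : IsLeast (addBoundedTypeDefinable L A (ringCoord N) κ)
      (AddSubgroup.toSubgroup.symm (comp00 L A (addCoord N) κ)) := by
    refine ⟨mem_addBoundedTypeDefinable_iff.2 ?_, fun H hH => ?_⟩
    · rw [OrderIso.apply_symm_apply]
      exact h.1
    · rw [OrderIso.symm_apply_le]
      exact h.2 (mem_addBoundedTypeDefinable_iff.1 hH)
  have heq : addComp00 L A (ringCoord N) κ =
      AddSubgroup.toSubgroup.symm (comp00 L A (addCoord N) κ) := h'.isGLB.sInf_eq
  rw [heq]
  exact ⟨h', OrderIso.apply_symm_apply _ _⟩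

theorem ker_toMultiplicative_mk' (H : AddSubgroup N) :
    MonoidHom.ker (AddMonoidHom.toMultiplicative (QuotientAddGroup.mk' H)) =
      AddSubgroup.toSubgroup H := by
  ext x
  exact QuotientAddGroup.eq_zero_iff (G := N) (N := H) (Multiplicative.toAdd x)

/-- The quotient map of the additive group by a type-definable subgroup of bounded index. -/
theorem isBoundedQuotient_mk {H : AddSubgroup N}
    (hH : H ∈ addBoundedTypeDefinable L A (ringCoord N) κ) :
    IsBoundedQuotient L A κ (addCoord N)
      (AddMonoidHom.toMultiplicative (QuotientAddGroup.mk' H)) := by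
  refine ⟨QuotientAddGroup.mk'_surjective H, ?_, hH.2⟩
  rw [ker_toMultiplicative_mk']
  exact hH.1

end Additive

/-! ### The sequence of subgroups of the additive group -/

section Sequence

variable {L : FirstOrder.Language.{u, v}} {N : Type w'} [Ring N] [L.Structure N] {κ : Cardinal.{w'}}

theorem mul_mem_iSeq {A : Set N} {k : ℕ} (hk : 1 ≤ k) (r : N) {x : N} (hx : x ∈ iSeq L A κ k) :
    r * x ∈ iSeq L A κ (k + 1) := by
  obtain ⟨k, rfl⟩ := Nat.exists_eq_add_of_le' hk
  exact (AddSubgroup.mem_sInf).2 fun H hH => hH.2 r x hx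

theorem iSeq_mono {A : Set N} {k l : ℕ} (hk : 1 ≤ k) (hkl : k ≤ l) :
    iSeq L A κ k ≤ iSeq L A κ l := by
  induction l, hkl using Nat.le_induction with
  | base => exact le_rfl
  | succ l hl ih =>
    refine ih.trans fun x hx => ?_
    simpa using mul_mem_iSeq (hk.trans hl) 1 hx

theorem iSeq_le_of_mul_mem {A : Set N} {k : ℕ} (hk : 1 ≤ k) {H : AddSubgroup N}
    (hH : IsTypeDefinable L A (ringCoord N) (H : Set N))
    (h : ∀ r : N, ∀ x ∈ iSeq L A κ k, r * x ∈ H) : iSeq L A κ (k + 1) ≤ H := by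
  obtain ⟨k, rfl⟩ := Nat.exists_eq_add_of_le' hk
  exact sInf_le ⟨hH, h⟩

theorem isTypeDefinable_iSeq {A : Set N} {k : ℕ} (hk : 1 ≤ k) :
    IsTypeDefinable L A (ringCoord N) (iSeq L A κ k : Set N) := by
  obtain ⟨k, rfl⟩ := Nat.exists_eq_add_of_le' hk
  cases k with
  | zero =>
    change IsTypeDefinable L A (ringCoord N) (addComp00 L A (ringCoord N) κ : Set N)
    rw [addComp00, AddSubgroup.coe_sInf]
    exact isCoord_ringCoord.isTypeDefinable_iInter fun H =>
      isCoord_ringCoord.isTypeDefinable_iInter fun hH => hH.1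
  | succ k =>
    rw [iSeq, AddSubgroup.coe_sInf]
    exact isCoord_ringCoord.isTypeDefinable_iInter fun H =>
      isCoord_ringCoord.isTypeDefinable_iInter fun hH => hH.1

variable {R : Type w} [Ring R] [L.Structure R] [CompatibleRing R] [CompatibleRing N]
  {j : R ↪ₑ[L] N}

theorem isLeast_iSeq_one (e : FirstOrder.Language.ring →ᴸ L) [e.IsExpansionOn R]
    [e.IsExpansionOn N] (hN : IsMonster κ j) :
    IsLeast (addBoundedTypeDefinable L (range j) (ringCoord N) κ) (iSeq L (range j) κ 1) :=
  (isLeast_addComp00 ((isDefGroup_addCoord e).isLeast_comp00 hN (isPoints_addCoord e j))).1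

theorem toSubgroup_iSeq_one (e : FirstOrder.Language.ring →ᴸ L) [e.IsExpansionOn R]
    [e.IsExpansionOn N] (hN : IsMonster κ j) :
    AddSubgroup.toSubgroup (iSeq L (range j) κ 1) = comp00 L (range j) (addCoord N) κ :=
  (isLeast_addComp00 ((isDefGroup_addCoord e).isLeast_comp00 hN (isPoints_addCoord e j))).2

theorem iSeq_mem_addBoundedTypeDefinable (e : FirstOrder.Language.ring →ᴸ L) [e.IsExpansionOn R]
    [e.IsExpansionOn N] (hN : IsMonster κ j) {k : ℕ} (hk : 1 ≤ k) :
    iSeq L (range j) κ k ∈ addBoundedTypeDefinable L (range j) (ringCoord N) κ := by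
  refine ⟨isTypeDefinable_iSeq hk, lt_of_le_of_lt ?_ (isLeast_iSeq_one e hN).1.2⟩
  have hle : iSeq L (range j) κ 1 ≤ iSeq L (range j) κ k := iSeq_mono le_rfl hk
  refine Cardinal.mk_le_of_surjective
    (f := QuotientAddGroup.map _ _ (AddMonoidHom.id N) hle) fun y => ?_
  obtain ⟨x, rfl⟩ := QuotientAddGroup.mk_surjective y
  exact ⟨x, rfl⟩

/-- The elements `a` with `a * N ⊆ H`. -/
def leftTransporter (H : AddSubgroup N) : AddSubgroup N where
  carrier := {a | ∀ b, a * b ∈ H}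
  add_mem' ha hb b := by rw [add_mul]; exact H.add_mem (ha b) (hb b)
  zero_mem' b := by rw [zero_mul]; exact H.zero_mem
  neg_mem' ha b := by rw [neg_mul]; exact H.neg_mem (ha b)

theorem isTypeDefinable_leftTransporter (e : FirstOrder.Language.ring →ᴸ L) [e.IsExpansionOn N]
    {A : Set N} {H : AddSubgroup N} (hH : IsTypeDefinable L A (ringCoord N) (H : Set N)) :
    IsTypeDefinable L A (ringCoord N) (leftTransporter H : Set N) :=
  IsTypeDefinable.forall (T := {p : N × N | p.1 * p.2 ∈ H})
    (hH.preimage (isCoord_ringCoord.prod isCoord_ringCoord) isCoord_ringCoord (isTermMap_mul e))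
    isCoord_ringCoord isCoord_ringCoord

/-- The subgroups of the sequence absorb multiplication on the right as well. The elements `a` with
`a * N ⊆ I (k + 1)` form a type-definable subgroup. For `k = 1` it has bounded index, since
`b ↦ a * b + I 2` depends only on `b + I 1`, so that there are few such maps. -/
theorem mul_mem_iSeq_right (e : FirstOrder.Language.ring →ᴸ L) [e.IsExpansionOn R]
    [e.IsExpansionOn N] (hN : IsMonster κ j) {k : ℕ} (hk : 1 ≤ k) {x : N}
    (hx : x ∈ iSeq L (range j) κ k) (r : N) : x * r ∈ iSeq L (range j) κ (k + 1) := by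
  suffices h : iSeq L (range j) κ k ≤ leftTransporter (iSeq L (range j) κ (k + 1)) from h hx r
  clear hx x r
  induction k, hk using Nat.le_induction with
  | base =>
    have h1 := iSeq_mem_addBoundedTypeDefinable e hN (le_refl 1)
    have h2 := iSeq_mem_addBoundedTypeDefinable e hN (show 1 ≤ 1 + 1 by simp)
    refine (isLeast_iSeq_one e hN).2 ⟨isTypeDefinable_leftTransporter e h2.1, ?_⟩
    have hlt : #((N ⧸ iSeq L (range j) κ 1) × (N ⧸ iSeq L (range j) κ (1 + 1))) < κ := by
      rw [Cardinal.mk_prod, Cardinal.lift_id, Cardinal.lift_id]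
      exact Cardinal.mul_lt_of_lt hN.aleph0_lt.le h1.2 h2.2
    refine hN.card_lt_of_injective hlt
      (f := fun i : N ⧸ leftTransporter (iSeq L (range j) κ (1 + 1)) =>
        range fun b : N => ((b : N ⧸ iSeq L (range j) κ 1),
          ((i.out * b : N) : N ⧸ iSeq L (range j) κ (1 + 1)))) fun i i' hii => ?_
    rw [← QuotientAddGroup.out_eq' i, ← QuotientAddGroup.out_eq' i', QuotientAddGroup.eq]
    intro b
    obtain ⟨b', hb'⟩ := (Set.ext_iff.1 hii ((b : N ⧸ iSeq L (range j) κ 1),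
      ((i.out * b : N) : N ⧸ iSeq L (range j) κ (1 + 1)))).1 ⟨b, rfl⟩
    rw [Prod.mk.injEq, QuotientAddGroup.eq, QuotientAddGroup.eq] at hb'
    have h3 := mul_mem_iSeq le_rfl i'.out hb'.1
    convert sub_mem h3 hb'.2 using 1
    noncomm_ring
  | succ k hk ih =>
    refine iSeq_le_of_mul_mem hk
      (isTypeDefinable_leftTransporter e (isTypeDefinable_iSeq (by lia))) fun r x hx b => ?_
    rw [mul_assoc]
    exact mul_mem_iSeq (by lia) r (ih hx b)

theorem cosetMulWellDefined_iSeq (e : FirstOrder.Language.ring →ᴸ L) [e.IsExpansionOn R]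
    [e.IsExpansionOn N] (hN : IsMonster κ j) : CosetMulWellDefined (iSeq L (range j) κ) := by
  intro i i' k hi hi' hik hik' a b x y hx hy
  have h1 : a * y ∈ iSeq L (range j) κ k := iSeq_mono (by lia) hik' (mul_mem_iSeq hi' a hy)
  have h2 : x * y ∈ iSeq L (range j) κ k := iSeq_mono (by lia) hik' (mul_mem_iSeq hi' x hy)
  have h3 : x * b ∈ iSeq L (range j) κ k :=
    iSeq_mono (by lia) hik (mul_mem_iSeq_right e hN hi hx b)
  convert add_mem (add_mem h1 h2) h3 using 1
  noncomm_ring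

end Sequence

/-! ### Elementary unitriangular matrices -/

section Elementary

variable {n : ℕ} {S : Type*} [Ring S]

/-- The elementary matrices with a given off-diagonal position, as a homomorphism from the additive
group. -/
def elemUT {i k : Fin n} (h : i < k) : Multiplicative S →* UT n S where
  toFun x := ⟨1 + Matrix.single i k x.toAdd, fun a b hab => by
      rw [Matrix.add_apply, Matrix.one_apply_ne hab.ne', Matrix.single_apply_of_ne, add_zero]
      rintro ⟨rfl, rfl⟩
      exact hab.not_gt h, fun a => by
      rw [Matrix.add_apply, Matrix.one_apply_eq, Matrix.single_apply_of_ne, add_zero]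
      rintro ⟨rfl, rfl⟩
      exact h.ne rfl⟩
  map_one' := Subtype.ext (by simp)
  map_mul' x y := Subtype.ext (by
    change 1 + Matrix.single i k (x.toAdd + y.toAdd) =
      (1 + Matrix.single i k x.toAdd) * (1 + Matrix.single i k y.toAdd)
    rw [mul_add, add_mul, add_mul, Matrix.single_mul_single_of_ne _ _ _ _ h.ne', Matrix.single_add]
    noncomm_ring)

theorem coe_elemUT {i k : Fin n} (h : i < k) (x : Multiplicative S) :
    (elemUT h x : Matrix (Fin n) (Fin n) S) = 1 + Matrix.single i k x.toAdd := rfl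

theorem elemUT_mul_apply_same {i k : Fin n} (h : i < k) (x : Multiplicative S) (a : UT n S)
    (l : Fin n) : ((elemUT h x * a : UT n S) : Matrix (Fin n) (Fin n) S) i l =
      a.1 i l + x.toAdd * a.1 k l := by
  rw [Submonoid.coe_mul, coe_elemUT, add_mul, one_mul, Matrix.add_apply,
    Matrix.single_mul_apply_same]

theorem elemUT_mul_apply_of_ne {i k : Fin n} (h : i < k) (x : Multiplicative S) (a : UT n S)
    {m : Fin n} (hm : m ≠ i) (l : Fin n) :
    ((elemUT h x * a : UT n S) : Matrix (Fin n) (Fin n) S) m l = a.1 m l := by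
  rw [Submonoid.coe_mul, coe_elemUT, add_mul, one_mul, Matrix.add_apply,
    Matrix.single_mul_apply_of_ne _ _ _ _ _ hm, add_zero]

/-- The commutator formula for elementary matrices. -/
theorem elemUT_mul_elemUT {i k l : Fin n} (h : i < k) (h' : k < l) (x y : S) :
    elemUT h (.ofAdd x) * elemUT h' (.ofAdd y) =
      elemUT (h.trans h') (.ofAdd (x * y)) * elemUT h' (.ofAdd y) * elemUT h (.ofAdd x) := by
  apply Subtype.ext
  simp only [Submonoid.coe_mul, coe_elemUT, toAdd_ofAdd, add_mul, mul_add, one_mul, mul_one,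
    Matrix.single_mul_single_same, Matrix.single_mul_single_of_ne _ _ _ _ h'.ne',
    Matrix.single_mul_single_of_ne _ _ _ _ (h.trans h').ne', add_zero]
  abel

/-- Gaussian elimination, row by row: a subgroup that contains the elementary matrices with entries
in a family of subgroups `J i k` contains every `a` in a subgroup `K` whose entries lie in these,
provided that `K` contains the elementary matrices as well. -/
theorem le_of_elemUT_mem {J : Fin n → Fin n → AddSubgroup S} {K U : Subgroup (UT n S)}
    (hK : ∀ a ∈ K, ∀ i k, i < k → a.1 i k ∈ J i k)
    (hJK : ∀ i k (h : i < k), ∀ x ∈ J i k, elemUT h (.ofAdd x) ∈ K)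
    (hJU : ∀ i k (h : i < k), ∀ x ∈ J i k, elemUT h (.ofAdd x) ∈ U) : K ≤ U := by
  -- downward induction on `m`, where the entries above the diagonal vanish at the positions `(i, k)`
  -- with `i * n + k < m`
  have key : ∀ d m, m + d = n * n → ∀ a ∈ K,
      (∀ i k : Fin n, i < k → (i * n + k : ℕ) < m → a.1 i k = 0) → a ∈ U := by
    intro d
    induction d with
    | zero =>
      intro m hm a _ h0
      have : a = 1 := Subtype.ext (Matrix.ext fun i k => by
        rcases lt_trichotomy i k with h | rfl | h
        · rw [h0 i k h (by nlinarith [i.2, k.2])]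
          exact (Matrix.one_apply_ne h.ne).symm
        · rw [a.2.2]; exact (Matrix.one_apply_eq i).symm
        · rw [a.2.1 i k h]; exact (Matrix.one_apply_ne h.ne').symm)
      rw [this]
      exact U.one_mem
    | succ d ih =>
      intro m hm a haK h0
      by_cases hex : ∃ i k : Fin n, i < k ∧ (i * n + k : ℕ) = m
      · obtain ⟨i, k, hik, rfl⟩ := hex
        have hmem := hK a haK i k hik
        have hb : elemUT hik (.ofAdd (-a.1 i k)) * a ∈ U := by
          refine ih (i * n + k + 1) (by lia) _
            (K.mul_mem (hJK i k hik _ (neg_mem hmem)) haK) fun i' k' h' hlt => ?_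
          by_cases hi : i' = i
          · subst hi
            rw [elemUT_mul_apply_same, toAdd_ofAdd]
            rcases lt_trichotomy k' k with hk | rfl | hk
            · rw [h0 i' k' h' (by have : (k' : ℕ) < k := hk; lia), a.2.1 k k' hk]
              simp
            · rw [a.2.2]; simp
            · have : (k : ℕ) < k' := hk
              lia
          · rw [elemUT_mul_apply_of_ne _ _ _ hi]
            refine h0 i' k' h' ?_
            have hne : (i' * n + k' : ℕ) ≠ i * n + k := fun heq => hi (Fin.ext (by
              have h1 := congrArg (· / n) heq
              simpa only [add_comm, Nat.add_mul_div_right _ _ i.pos, Nat.div_eq_of_lt k.2,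
                Nat.div_eq_of_lt k'.2, zero_add, add_zero] using h1))
            lia
        have := U.mul_mem (U.inv_mem (hJU i k hik _ (neg_mem hmem))) hb
        rwa [inv_mul_cancel_left] at this
      · refine ih (m + 1) (by lia) a haK fun i k hik hlt => ?_
        rcases Nat.lt_succ_iff_lt_or_eq.1 hlt with h | h
        · exact h0 i k hik h
        · exact absurd ⟨i, k, hik, h⟩ hex
  exact fun a ha => key (n * n) 0 (by simp) a ha fun _ _ _ h => absurd h (Nat.not_lt_zero _)

end Elementary

/-! ### The component of the unitriangular group -/

section Unitriangular

variable {L : FirstOrder.Language.{u, v}} {R : Type w} {N : Type w'} [Ring R] [Ring N]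
  [CompatibleRing R] [CompatibleRing N] [L.Structure R] [L.Structure N] {j : R ↪ₑ[L] N}
  {κ : Cardinal.{w'}} {n : ℕ}

theorem UTQuot.mk_eq_mk_iff {S : Type*} [Ring S] {I : ℕ → AddSubgroup S} {a b : UT n S} :
    UTQuot.mk I a = UTQuot.mk I b ↔ ∀ i k : Fin n, i < k → -a.1 i k + b.1 i k ∈ I (k - i) := by
  refine funext_iff.trans ⟨?_, ?_⟩
  · exact fun h i k hik => QuotientAddGroup.eq.1 (h ⟨(i, k), hik⟩)
  · exact fun h p => QuotientAddGroup.eq.2 (h p.1.1 p.1.2 p.2)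

theorem UTQuot.mem_ker_mkHom_iff {S : Type*} [Ring S] {I : ℕ → AddSubgroup S}
    (hI : CosetMulWellDefined I) {a : UT n S} :
    letI := UTQuot.group hI n
    a ∈ (UTQuot.mkHom hI n).ker ↔ ∀ i k : Fin n, i < k → a.1 i k ∈ I (k - i) := by
  let _ := UTQuot.group hI n
  rw [MonoidHom.mem_ker, eq_comm]
  refine (UTQuot.mk_eq_mk_iff (a := 1)).trans
    (forall_congr' fun i => forall_congr' fun k => forall_congr' fun h => ?_)
  have : ((1 : UT n S) : Matrix (Fin n) (Fin n) S) i k = 0 := Matrix.one_apply_ne h.ne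
  rw [this, neg_zero, zero_add]

/-- The coordinatewise quotient map is a bounded quotient of the unitriangular group: the image of
a matrix is determined by the types of its entries. -/
theorem isBoundedQuotient_mkHom (e : FirstOrder.Language.ring →ᴸ L) [e.IsExpansionOn R]
    [e.IsExpansionOn N] (hN : IsMonster κ j) (hI : CosetMulWellDefined (iSeq L (range j) κ)) :
    letI := UTQuot.group hI n
    IsBoundedQuotient L (range j) κ (utCoord n N) (UTQuot.mkHom hI n) := by
  let _ := UTQuot.group hI n
  have hG : IsDefGroup L (range j) (utCoord n N) := isDefGroup_utCoord e
  refine ⟨UTQuot.mk_surjective, ?_, ?_⟩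
  · have : ((UTQuot.mkHom hI n).ker : Set (UT n N)) = ⋂ (i : Fin n) (k : Fin n) (_ : i < k),
        (fun a : UT n N => (a : Matrix (Fin n) (Fin n) N) i k) ⁻¹'
          (iSeq L (range j) κ (k - i) : Set N) := by
      ext a
      simp only [mem_iInter]
      exact UTQuot.mem_ker_mkHom_iff hI
    rw [this]
    refine hG.coord.isTypeDefinable_iInter fun i => hG.coord.isTypeDefinable_iInter fun k =>
      hG.coord.isTypeDefinable_iInter fun hik => ?_
    have : (i : ℕ) < k := hik
    exact (isTypeDefinable_iSeq (by lia)).preimage hG.coord isCoord_ringCoord (isTermMap_entry i k)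
  · have h := hN.card_quotient_lt hG.coord.1 (H := (UTQuot.mkHom hI n).ker) fun x y hxy => by
      rw [← QuotientGroup.eq, QuotientGroup.eq, MonoidHom.mem_ker, map_mul, map_inv,
        inv_mul_eq_one]
      refine UTQuot.mk_eq_mk_iff.2 fun i k hik => ?_
      have : (i : ℕ) < k := hik
      have hmem := mem_addBoundedTypeDefinable_iff.1
        (iSeq_mem_addBoundedTypeDefinable e hN (show 1 ≤ (k - i : ℕ) by lia))
      exact (isDefGroup_addCoord e).inv_mul_mem_of_sameType hN (isPoints_addCoord e j) hmem.1
        hmem.2 (x := .ofAdd (x.1 i k)) (y := .ofAdd (y.1 i k)) fun D hD =>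
          (hxy _ (hD.preimage hG.coord (isDefGroup_addCoord (A := range j) e).coord.1
            (isTermMap_entry i k))).1
    rwa [Cardinal.mk_congr (QuotientGroup.quotientKerEquivOfSurjective (UTQuot.mkHom hI n)
      UTQuot.mk_surjective).toEquiv] at h

/-- The matrices whose entries lie in the subgroups `I (k - i)` form the component `UT_n(N)^00`.
Such matrices are products of elementary ones, and the component contains the elementary matrices
with entries in `I (k - i)` by the commutator formula and the minimality of these subgroups. -/
theorem ker_mkHom_eq_comp00 (e : FirstOrder.Language.ring →ᴸ L) [e.IsExpansionOn R]
    [e.IsExpansionOn N] (hN : IsMonster κ j) (hI : CosetMulWellDefined (iSeq L (range j) κ)) :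
    letI := UTQuot.group hI n
    (UTQuot.mkHom hI n).ker = comp00 L (range j) (utCoord n N) κ := by
  let _ := UTQuot.group hI n
  have hG : IsDefGroup L (range j) (utCoord n N) := isDefGroup_utCoord e
  have hQ := isBoundedQuotient_mkHom (n := n) e hN hI
  have hU := hG.isLeast_comp00 hN (isPoints_utCoord e j)
  have hnormal := hG.comp00_normal hN (isPoints_utCoord e j)
  set U := comp00 L (range j) (utCoord n N) κ
  refine le_antisymm ?_ (hU.2 ⟨hQ.2, ?_⟩)
  · have helem : ∀ i k : Fin n, ∀ h : i < k,
        IsTermMap L (range j) (addCoord N) (utCoord n N) (elemUT h) := by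
      rintro i k h ⟨a, b⟩
      by_cases hab : i = a ∧ k = b
      · obtain ⟨rfl, rfl⟩ := hab
        have : IsTermFun L (range j) (addCoord N) fun x => addCoord N x 0 := .coord 0
        obtain ⟨s, hs⟩ := (IsTermFun.matrix_one e i k).add e this
        exact ⟨s, fun x => (hs x).trans (by simp [utCoord, coe_elemUT, ringCoord])⟩
      · obtain ⟨s, hs⟩ := IsTermFun.matrix_one (A := range j) (c := addCoord N) e a b
        exact ⟨s, fun x => (hs x).trans (by
          simp [utCoord, coe_elemUT, Matrix.single_apply_of_ne _ _ _ _ _ hab])⟩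
    have hcomap : ∀ i k : Fin n, ∀ h : i < k,
        AddSubgroup.toSubgroup.symm (U.comap (elemUT h)) ∈
          addBoundedTypeDefinable L (range j) (ringCoord N) κ := fun i k h => by
      rw [mem_addBoundedTypeDefinable_iff, OrderIso.apply_symm_apply]
      exact hG.comap_mem_boundedTypeDefinable (isDefGroup_addCoord e).coord (helem i k h) hU.1
    have key : ∀ d : ℕ, ∀ i k : Fin n, ∀ h : i < k, (k - i : ℕ) = d + 1 →
        iSeq L (range j) κ (d + 1) ≤ AddSubgroup.toSubgroup.symm (U.comap (elemUT h)) := by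
      intro d
      induction d with
      | zero => exact fun i k h _ => (isLeast_iSeq_one e hN).2 (hcomap i k h)
      | succ d ih =>
        intro i k h hd
        refine iSeq_le_of_mul_mem (by lia) (hcomap i k h).1 fun r x hx => ?_
        let l : Fin n := ⟨i + 1, by lia⟩
        have hil : i < l := Nat.lt_succ_self _
        have hlk : l < k := show (i + 1 : ℕ) < k by lia
        have hxU : elemUT hlk (.ofAdd x) ∈ U := ih l k hlk (show (k - (i + 1) : ℕ) = _ by lia) hx
        have hcomm := elemUT_mul_elemUT hil hlk r x
        -- the commutator of two elementary matrices, the second of which lies in `U`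
        have h1 := U.mul_mem (hnormal.conj_mem _ hxU (elemUT hil (.ofAdd r))) (U.inv_mem hxU)
        rw [hcomm, mul_inv_cancel_right, mul_inv_cancel_right] at h1
        exact h1
    refine le_of_elemUT_mem (J := fun i k => iSeq L (range j) κ (k - i))
      (fun a ha => (UTQuot.mem_ker_mkHom_iff hI).1 ha) (fun i k h x hx => ?_) fun i k h x hx => ?_
    · refine (UTQuot.mem_ker_mkHom_iff hI).2 fun a b hab => ?_
      rw [coe_elemUT, Matrix.add_apply, Matrix.one_apply_ne hab.ne, zero_add]
      by_cases h' : i = a ∧ k = b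
      · obtain ⟨rfl, rfl⟩ := h'
        simpa using hx
      · rw [Matrix.single_apply_of_ne _ _ _ _ _ h']
        exact zero_mem _
    · have : (i : ℕ) < k := h
      obtain ⟨d, hd⟩ := Nat.exists_eq_add_of_le' (show 1 ≤ (k - i : ℕ) by lia)
      rw [hd] at hx
      exact key d i k h hd hx
  · rw [Cardinal.mk_congr (QuotientGroup.quotientKerEquivOfSurjective (UTQuot.mkHom hI n)
      UTQuot.mk_surjective).toEquiv]
    exact hQ.3

/-- The logic topology on the group of matrices of cosets is the product topology: the former is
compact, the latter Hausdorff, and the coordinate projections are continuous. -/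
theorem topology_eq_logicTopology (e : FirstOrder.Language.ring →ᴸ L) [e.IsExpansionOn R]
    [e.IsExpansionOn N] (hN : IsMonster κ j) (hI : CosetMulWellDefined (iSeq L (range j) κ)) :
    letI := UTQuot.group hI n
    UTQuot.topology (fun k => logicTopology L (ringCoord N) κ
      (QuotientAddGroup.mk : N → N ⧸ iSeq L (range j) κ k)) n =
      logicTopology L (utCoord n N) κ (UTQuot.mkHom hI n) := by
  let _ := UTQuot.group hI n
  have hG : IsDefGroup L (range j) (utCoord n N) := isDefGroup_utCoord e
  have hQ := isBoundedQuotient_mkHom (n := n) e hN hI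
  have hpos : ∀ p : {p : Fin n × Fin n // p.1 < p.2}, 1 ≤ (p.1.2 - p.1.1 : ℕ) := fun p => by
    have : (p.1.1 : ℕ) < p.1.2 := p.2
    lia
  let τ : ∀ k, TopologicalSpace (N ⧸ iSeq L (range j) κ k) := fun k =>
    logicTopology L (ringCoord N) κ QuotientAddGroup.mk
  have hq : ∀ p : {p : Fin n × Fin n // p.1 < p.2}, IsBoundedQuotient L (range j) κ (addCoord N)
      (AddMonoidHom.toMultiplicative (QuotientAddGroup.mk' (iSeq L (range j) κ _))) := fun p =>
    isBoundedQuotient_mk (iSeq_mem_addBoundedTypeDefinable e hN (hpos p))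
  have hT2 : ∀ p : {p : Fin n × Fin n // p.1 < p.2},
      T2Space (N ⧸ iSeq L (range j) κ (p.1.2 - p.1.1 : ℕ)) := fun p =>
    (hq p).t2Space (isDefGroup_addCoord e) hN
  have hT2' : @T2Space _ (UTQuot.topology τ n) :=
    @Pi.t2Space _ _ (fun _ => τ _) hT2
  have hle : logicTopology L (utCoord n N) κ (UTQuot.mkHom hI n) ≤ UTQuot.topology τ n := by
    rw [← continuous_id_iff_le]
    refine @continuous_pi _ _ _ (_) _ _ fun p => ?_
    let _ := logicTopology L (utCoord n N) κ (UTQuot.mkHom hI n)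
    refine continuous_iff_isClosed.2 fun C hC => ?_
    obtain ⟨B, hB, hBC⟩ := ((hq p).isLogicTopology (isDefGroup_addCoord e) hN C).1 hC
    rw [hQ.isLogicTopology hG hN]
    refine ⟨range j ∪ B, (Cardinal.mk_union_le _ _).trans_lt
      (Cardinal.add_lt_of_lt hN.aleph0_lt.le hN.card_range_lt hB), ?_⟩
    exact (IsTypeDefinable.mono hBC subset_union_right).preimage
      (hG.coord.mono subset_union_left) isCoord_ringCoord
      (isTermMap_entry p.1.1 p.1.2)
  refine le_antisymm ?_ hle
  have hcompact := hQ.compactSpace hG hN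
  exact continuous_id_iff_le.1 (@Homeomorph.continuous_invFun _ _ (_) (_)
    (@Continuous.homeoOfEquivCompactToT2 _ _ (logicTopology L (utCoord n N) κ
      (UTQuot.mkHom hI n)) (UTQuot.topology τ n) hcompact hT2' (Equiv.refl _)
      (continuous_id_iff_le.2 hle)))

end Unitriangular

end DefBohr

open FirstOrder.Ring DefBohr
theorem proposition3p8
    -- `R` is a unital ring with additional structure, in a language `L` expanding that of rings;
    -- `N` is the fixed monster extension of `R`
    {L : FirstOrder.Language.{u, v}} {R : Type w} {N : Type w'} [Ring R] [Ring N]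
    [CompatibleRing R] [CompatibleRing N] [L.Structure R] [L.Structure N]
    (ι : FirstOrder.Language.ring →ᴸ L) [ι.IsExpansionOn R] [ι.IsExpansionOn N]
    (j : R ↪ₑ[L] N) (κ : Cardinal.{w'}) (hN : IsMonster κ j) (n : ℕ) :
    -- parameters: the elements of `R`
    let A : Set N := Set.range j
    let I : ℕ → AddSubgroup N := iSeq L A κ
    -- `UT_n(N)^00_R`
    let U : Subgroup (UT n N) := comp00 L A (utCoord n N) κ
    -- logic topologies
    let τ : ∀ k, TopologicalSpace (N ⧸ I k) :=
      fun k => logicTopology L (ringCoord N) κ (QuotientAddGroup.mk : N → N ⧸ I k)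
    let τU : TopologicalSpace (UT n N ⧸ U) :=
      logicTopology L (utCoord n N) κ (QuotientGroup.mk : UT n N → UT n N ⧸ U)
    -- the components are indeed the smallest subgroups of the required kind
    IsLeast (addBoundedTypeDefinable L A (ringCoord N) κ) (I 1) ∧
    IsLeast (boundedTypeDefinable L A (utCoord n N) κ) U ∧
    (∀ k, 1 ≤ k → IsLogicTopology L (ringCoord N) κ (QuotientAddGroup.mk : N → N ⧸ I k) (τ k)) ∧
    IsLogicTopology L (utCoord n N) κ (QuotientGroup.mk : UT n N → UT n N ⧸ U) τU ∧
    -- `N / I 1` is the definable Bohr compactification of `(R, +)`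
    (letI := τ 1
     IsDefinableBohr.{u, v, w, t} L (fun x : Multiplicative R => ringCoord R x.toAdd)
      (AddMonoidHom.toMultiplicative
        ((QuotientAddGroup.mk' (I 1)).comp (elemRingHom ι j).toAddMonoidHom))) ∧
    ∃ (hI : CosetMulWellDefined I) (_ : U.Normal),
      letI := τU
      letI : Group (UTQuot I n) := UTQuot.group hI n
      letI : TopologicalSpace (UTQuot I n) := UTQuot.topology τ n
      -- the quotient is the definable Bohr compactification of `UT_n(R)`
      IsDefinableBohr.{u, v, w, t} L (utCoord n R)
        ((QuotientGroup.mk' U).comp (UT.map (elemRingHom ι j))) ∧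
      -- it is isomorphic to the group of matrices, via the coordinatewise quotient maps
      (∃ e : (UT n N ⧸ U) ≃ₜ* UTQuot I n, ∀ a : UT n N, e (QuotientGroup.mk a) = UTQuot.mk I a) ∧
      -- so the coordinatewise map is the definable Bohr compactification
      IsDefinableBohr.{u, v, w, t} L (utCoord n R)
        ((UTQuot.mkHom hI n).comp (UT.map (elemRingHom ι j))) := by

  intro A I U τ τU
  have hGa : IsDefGroup L A (addCoord N) := isDefGroup_addCoord ι
  have hGu : IsDefGroup L A (utCoord n N) := isDefGroup_utCoord ι
  have hPa := isPoints_addCoord ι j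
  have hPu := isPoints_utCoord (n := n) ι j
  have hI : CosetMulWellDefined I := cosetMulWellDefined_iSeq ι hN
  have hq : ∀ k, 1 ≤ k → IsBoundedQuotient L A κ (addCoord N)
      (AddMonoidHom.toMultiplicative (QuotientAddGroup.mk' (I k))) := fun k hk =>
    isBoundedQuotient_mk (iSeq_mem_addBoundedTypeDefinable ι hN hk)
  have hU : IsLeast (boundedTypeDefinable L A (utCoord n N) κ) U := hGu.isLeast_comp00 hN hPu
  have hUn : U.Normal := hGu.comp00_normal hN hPu
  have hkerU : (QuotientGroup.mk' U).ker = U := QuotientGroup.ker_mk' U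
  have hqU : IsBoundedQuotient L A κ (utCoord n N) (QuotientGroup.mk' U) :=
    ⟨QuotientGroup.mk'_surjective U, by rw [hkerU]; exact hU.1.1, hU.1.2⟩
  refine ⟨isLeast_iSeq_one ι hN, hU, fun k hk => (hq k hk).isLogicTopology hGa hN,
    hqU.isLogicTopology hGu hN, ?_, hI, hUn, ?_⟩
  · refine (hq 1 le_rfl).isDefinableBohr ?_ hGa hN hPa fun x y h => congrFun h 0
    rw [ker_toMultiplicative_mk', ← toSubgroup_iSeq_one ι hN]
  · let _ : Group (UTQuot I n) := UTQuot.group hI n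
    have hqM : IsBoundedQuotient L A κ (utCoord n N) (UTQuot.mkHom hI n) :=
      isBoundedQuotient_mkHom ι hN hI
    have hkerM : (UTQuot.mkHom hI n).ker = U := ker_mkHom_eq_comp00 ι hN hI
    have htop : UTQuot.topology τ n = logicTopology L (utCoord n N) κ (UTQuot.mkHom hI n) :=
      topology_eq_logicTopology ι hN hI
    have hinj : Function.Injective (utCoord n R) :=
      fun x y h => Subtype.ext (Matrix.ext fun i k => congrFun h (i, k))
    rw [htop]
    exact ⟨hqU.isDefinableBohr hkerU hGu hN hPu hinj,
      hqU.exists_continuousMulEquiv hqM hGu hN (hkerU.trans hkerM.symm),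
      hqM.isDefinableBohr hkerM hGu hN hPu hinj⟩
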